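/- Let $\square=[0,1]^2$, $Z=(\tfrac12,\tfrac12)$, and let $R(x,y)=(1-y,x)$ be the rotation about $Z$ by $\pi/2$. Let $E_1=(0,0)$, $E_2=(1,0)$, $E_3=(1,1)$, $E_4=(0,1)$, with indices in $\{1,2,3,4\}$ taken cyclically. For $\theta\in(0,\frac{\pi}{4})$ let $L_i$ be the ray from $E_i$ into $\square$ making the angle $\theta$ with $\overline{E_iE_{i+1}}$, and let $P_i=L_{i-1}\cap L_i$; so $P_1=(s,t)$ with $s=\sin\theta\cos\theta$, $t=\sin^2\theta$, and $P_{i+1}=R(P_i)$. Let $P_1'=(1-s,t)$ and $P_{i+1}'=R(P_i')$. Let $F=F_\theta:\square\to\square$ be the continuous map with $F(E_i)=E_i$ and $F(P_i)=P_i'$ that is affine on each of the triangles $\mathcal A_i=\Delta(E_i,E_{i+1},P_i)$ and $\mathcal B_i=\Delta(E_i,P_i,P_{i-1})$ and on the square $\mathcal C=\square(P_1,P_2,P_3,P_4)$. For $K\ge 3$, call $\theta\in(0,\frac\pi4)$ a *parameter $\theta_K$* if $F_\theta^k(\overline{E_1P_4})\subset\mathcal B_1$ for $0\le k<K$ and $F_\theta^K(\overline{E_1P_4})=\overline{E_1P_1}$,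 and then let $$\Gamma_K^0=\bigcup_{i=0}^{4K-1}\overline{F^i(P_4)F^{i+1}(P_4)} .$$ A *rotationally symmetric invariant circle* is a simple closed curve $\Gamma\subset\square$ encircling $Z$ with $F(\Gamma)=\Gamma$ and $R(\Gamma)=\Gamma$, on which $F$ preserves the cyclic order of points. Its rotation number $\rho(F|_\Gamma)$ is taken with respect to the counterclockwise orientation and represented in $[0,1)$. **Corollary.** For every $K\ge3$ there is a parameter $\theta_K$, and these can be chosen such that $\theta_K\to\frac\pi4$ as $K\to\infty$. For every $K\geq 3$ and every parameter $\theta=\theta_K$, the set $\Gamma_K^0$ contains all the points $P_i$ and $P_i'$, and the closed annulus between $\partial\square$ and $\Gamma_K^0$ (that is, $\square$ without the component of $\square\setminus\Gamma_K^0$ containing $Z$) is completely foliated by rotationally symmetric invariant circles whose rotation numbers vary continuously and strictly monotonically from $0$ on $\partial\square$ to $\frac1{4K}$ on $\Gamma_K^0$. More precisely, there are a homeomorphism $h$ from $S^1\times[0,1]$ onto this annulus and a continuous, strictly increasing function $\rho:[0,1]\to\mathbb R$ such that $\rho(0)=0$, $\rho(1)=\frac1{4K}$, $h(S^1\times\{0\})=\partial\square$,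 $h(S^1\times\{1\})=\Gamma_K^0$, and, for every $\tau\in[0,1]$, $h(S^1\times\{\tau\})$ is a rotationally symmetric invariant circle with rotation number $\rho(\tau)$. -/

import Mathlib

open Set Filter Topology

namespace SquareMap

noncomputable section

/-- The unit square `[0,1] × [0,1]`. -/
def square : Set (ℝ × ℝ) := Icc 0 1 ×ˢ Icc 0 1

/-- The centre `Z` of the square. -/
def Z : ℝ × ℝ := (1 / 2, 1 / 2)

/-- `R`, the counterclockwise rotation about `Z` by `π/2`. -/
def rot (p : ℝ × ℝ) : ℝ × ℝ := (1 - p.2, p.1)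

theorem rot_four (p : ℝ × ℝ) : rot^[4] p = p := by
  simp [rot]

/-- The map `R^i ∘ f ∘ R^(-i)` (for `0 ≤ i ≤ 4`). -/
def turn (i : ℕ) (f : ℝ × ℝ → ℝ × ℝ) (p : ℝ × ℝ) : ℝ × ℝ := rot^[i] (f (rot^[4 - i] p))

/-! The indices `i = 0, 1, 2, 3` below stand for `1, 2, 3, 4` in the usual labelling of the
vertices in counterclockwise order. All families are periodic in `i` with period `4`,
so that `i + 3` is the cyclic predecessor of `i`. -/

/-- The vertices `(0,0), (1,0), (1,1), (0,1)` of the square. -/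
def E (i : ℕ) : ℝ × ℝ := rot^[i] (0, 0)

/-- The ray from the vertex `E i` into the square that makes the angle `θ` with the side from
`E i` to `E (i + 1)`. -/
def ray (θ : ℝ) (i : ℕ) : Set (ℝ × ℝ) :=
  {p | ∃ r : ℝ, 0 ≤ r ∧ p = rot^[i] (r * Real.cos θ, r * Real.sin θ)}

/-- The first coordinate of `P 0`. -/
def sc (θ : ℝ) : ℝ := Real.sin θ * Real.cos θ

/-- The second coordinate of `P 0`. -/
def tc (θ : ℝ) : ℝ := Real.sin θ ^ 2

/-- The vertices of the inner square; `P θ i` is the intersection point of the rays from `E i`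
and from its predecessor, see `ray_inter_ray`. -/
def P (θ : ℝ) (i : ℕ) : ℝ × ℝ := rot^[i] (sc θ, tc θ)

/-- The vertices of the inner square in the mirrored construction, where `P' θ 0` is the one at
the height of `P θ 0`. -/
def P' (θ : ℝ) (i : ℕ) : ℝ × ℝ := rot^[i] (1 - sc θ, tc θ)

theorem ray_inter_ray (θ : ℝ) (h0 : 0 < θ) (h1 : θ < Real.pi / 4) (i : ℕ) :
    ray θ i ∩ ray θ (i + 3) = {P θ i} := by
  have hinj : Function.Injective rot := by
    rintro ⟨a, b⟩ ⟨c, d⟩ h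
    simp only [rot, Prod.mk.injEq] at h ⊢
    constructor <;> linarith
  have hs : 0 < Real.sin θ := Real.sin_pos_of_pos_of_lt_pi h0 (by linarith [Real.pi_pos])
  have hc : 0 < Real.cos θ :=
    Real.cos_pos_of_mem_Ioo ⟨by linarith [Real.pi_pos], by linarith [Real.pi_pos]⟩
  have hsc := Real.sin_sq_add_cos_sq θ
  ext p
  simp only [ray, mem_inter_iff, mem_ofPred_eq, mem_singleton_iff, P]
  constructor
  · rintro ⟨⟨r, hr, rfl⟩, r', hr', h⟩
    rw [Function.iterate_add_apply] at h
    have h := hinj.iterate i h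
    simp only [Function.iterate_succ, Function.iterate_zero, Function.comp_apply, rot, id_eq,
      Prod.mk.injEq] at h
    have hr : r = Real.sin θ := by
      have e1 : r * Real.sin θ = 1 - r' * Real.cos θ := by linarith [h.2]
      have e2 : r * Real.cos θ = r' * Real.sin θ := by linarith [h.1]
      linear_combination (-r) * hsc + Real.sin θ * e1 + Real.cos θ * e2
    simp only [hr, sc, tc, sq]
  · rintro rfl
    refine ⟨⟨Real.sin θ, hs.le, by simp only [sc, tc, sq]⟩, Real.cos θ, hc.le, ?_⟩
    rw [Function.iterate_add_apply]
    congr 1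
    simp only [Function.iterate_succ, Function.iterate_zero, Function.comp_apply, rot, id_eq,
      Prod.mk.injEq, sc, tc]
    constructor
    · ring
    · linarith

/-- The triangle with vertices `E i`, `E (i + 1)`, `P i`. -/
def pieceA (θ : ℝ) (i : ℕ) : Set (ℝ × ℝ) := convexHull ℝ {E i, E (i + 1), P θ i}

/-- The triangle with vertices `E i`, `P i`, `P (i - 1)`. -/
def pieceB (θ : ℝ) (i : ℕ) : Set (ℝ × ℝ) := convexHull ℝ {E i, P θ i, P θ (i + 3)}

/-- The inner square. -/
def pieceC (θ : ℝ) : Set (ℝ × ℝ) := convexHull ℝ {P θ 0, P θ 1, P θ 2, P θ 3}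

/-- The shear that fixes `E 0` and `E 1` and maps `P 0` to `P' 0`. -/
def mapA (θ : ℝ) (p : ℝ × ℝ) : ℝ × ℝ := (p.1 + (1 - 2 * sc θ) / tc θ * p.2, p.2)

/-- The linear map that maps `P 0` to `P' 0` and `P 3` to `P' 3`. -/
def mapB (θ : ℝ) (p : ℝ × ℝ) : ℝ × ℝ :=
  (((tc θ ^ 2 - (1 - sc θ) ^ 2) * p.1 + (1 - 2 * sc θ) * tc θ * p.2) / (tc θ - sc θ),
   ((2 * sc θ - 1) * tc θ * p.1 + (2 * tc θ - 1) * tc θ * p.2) / (tc θ - sc θ))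

/-- The rotation about `Z` that maps `P i` to `P' i`. -/
def mapC (θ : ℝ) (p : ℝ × ℝ) : ℝ × ℝ :=
  (2 * sc θ * p.1 + (2 * tc θ - 1) * p.2 + (1 - tc θ - sc θ),
   (1 - 2 * tc θ) * p.1 + 2 * sc θ * p.2 + (tc θ - sc θ))

theorem sc_sq (θ : ℝ) : sc θ ^ 2 = tc θ - tc θ ^ 2 := by
  have h := Real.sin_sq_add_cos_sq θ
  simp only [sc, tc]
  linear_combination Real.sin θ ^ 2 * h

theorem tc_pos {θ : ℝ} (h0 : 0 < θ) (h1 : θ < Real.pi / 4) : 0 < tc θ :=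
  pow_pos (Real.sin_pos_of_pos_of_lt_pi h0 (by linarith [Real.pi_pos])) 2

theorem tc_lt_sc {θ : ℝ} (h0 : 0 < θ) (h1 : θ < Real.pi / 4) : tc θ < sc θ := by
  have hs : 0 < Real.sin θ := Real.sin_pos_of_pos_of_lt_pi h0 (by linarith [Real.pi_pos])
  have h : Real.sin θ < Real.cos θ := by
    rw [← Real.cos_pi_div_two_sub]
    exact Real.cos_lt_cos_of_nonneg_of_le_pi_div_two h0.le (by linarith) (by linarith)
  simp only [sc, tc, sq]
  exact mul_lt_mul_of_pos_left h hs

theorem mapA_vertices {θ : ℝ} (h0 : 0 < θ) (h1 : θ < Real.pi / 4) :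
    mapA θ (E 0) = E 0 ∧ mapA θ (E 1) = E 1 ∧ mapA θ (P θ 0) = P' θ 0 := by
  have ht := (tc_pos h0 h1).ne'
  refine ⟨?_, ?_, ?_⟩ <;> simp [mapA, E, P, P', rot]
  field_simp
  ring

theorem mapB_vertices {θ : ℝ} (h0 : 0 < θ) (h1 : θ < Real.pi / 4) :
    mapB θ (E 0) = E 0 ∧ mapB θ (P θ 0) = P' θ 0 ∧ mapB θ (P θ 3) = P' θ 3 := by
  have hst : tc θ - sc θ ≠ 0 := (sub_neg.2 (tc_lt_sc h0 h1)).ne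
  have h := sc_sq θ
  refine ⟨?_, ?_, ?_⟩
  · simp [mapB, E]
  · simp only [mapB, P, P', Function.iterate_zero, id_eq, Prod.mk.injEq]
    constructor
    · rw [div_eq_iff hst]
      linear_combination (1 - sc θ) * h
    · rw [div_eq_iff hst]
      linear_combination 2 * tc θ * h
  · simp only [mapB, P, P', Function.iterate_succ, Function.iterate_zero, Function.comp_apply,
      rot, id_eq, Prod.mk.injEq]
    constructor
    · rw [div_eq_iff hst]
      linear_combination tc θ * h
    · rw [div_eq_iff hst]
      linear_combination h

theorem mapC_vertices (θ : ℝ) : mapC θ (P θ 0) = P' θ 0 ∧ mapC θ (P θ 1) = P' θ 1 ∧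
    mapC θ (P θ 2) = P' θ 2 ∧ mapC θ (P θ 3) = P' θ 3 := by
  have h := sc_sq θ
  refine ⟨?_, ?_, ?_, ?_⟩ <;>
  simp only [mapC, P, P', Function.iterate_succ, Function.iterate_zero, Function.comp_apply,
    rot, id_eq, Prod.mk.injEq] <;> constructor <;> grind

open Classical in
/-- The piecewise affine map `F = F_θ` of the square, `0 < θ < π/4`: it fixes the points `E i`, maps
`P i` to `P' i`, and is affine on each of the nine pieces. (It is used only on the square;
outside the square it is the identity, so that it can be iterated.) -/
def F (θ : ℝ) (p : ℝ × ℝ) : ℝ × ℝ :=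
  if p ∈ pieceA θ 0 then mapA θ p
  else if p ∈ pieceA θ 1 then turn 1 (mapA θ) p
  else if p ∈ pieceA θ 2 then turn 2 (mapA θ) p
  else if p ∈ pieceA θ 3 then turn 3 (mapA θ) p
  else if p ∈ pieceB θ 0 then mapB θ p
  else if p ∈ pieceB θ 1 then turn 1 (mapB θ) p
  else if p ∈ pieceB θ 2 then turn 2 (mapB θ) p
  else if p ∈ pieceB θ 3 then turn 3 (mapB θ) p
  else if p ∈ pieceC θ then mapC θ p
  else p

/-- `θ` is a parameter `θ_K`: the images under `F^k`, `0 ≤ k < K`, of the segment from `E 0` to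
`P 3` lie in the triangle `pieceB θ 0`, and its image under `F^K` is the segment from `E 0`
to `P 0`. -/
structure IsSpecialParameter (K : ℕ) (θ : ℝ) : Prop where
  pos : 0 < θ
  lt : θ < Real.pi / 4
  mem : ∀ k < K, (F θ)^[k] '' segment ℝ (E 0) (P θ 3) ⊆ pieceB θ 0
  hit : (F θ)^[K] '' segment ℝ (E 0) (P θ 3) = segment ℝ (E 0) (P θ 0)

/-- The polygon `Γ_K^0`: the segments joining successive iterates of `P 3`. -/
def Gamma0 (θ : ℝ) (K : ℕ) : Set (ℝ × ℝ) :=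
  ⋃ i ∈ Finset.range (4 * K), segment ℝ ((F θ)^[i] (P θ 3)) ((F θ)^[i + 1] (P θ 3))

/-- The closed annulus between the boundary of the square and `Γ` (both included): the square
without the component of `square \ Γ` that contains the centre. -/
def annulus (Γ : Set (ℝ × ℝ)) : Set (ℝ × ℝ) := square \ connectedComponentIn (square \ Γ) Z

/-- `γ` is a one-periodic parametrization of the simple closed curve `Γ`, which avoids `Z` and runs
once around `Z` counterclockwise: `ψ` is a continuous choice of the polar angle about `Z`, measured
in full turns. -/
structure IsCcwParam (Γ : Set (ℝ × ℝ)) (γ : ℝ → ℝ × ℝ) : Prop where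
  cont : Continuous γ
  periodic : ∀ x, γ (x + 1) = γ x
  inj : InjOn γ (Ico 0 1)
  range_eq : range γ = Γ
  winding : ∃ r ψ : ℝ → ℝ, Continuous ψ ∧ (∀ x, 0 < r x) ∧ (∀ x, ψ (x + 1) = ψ x + 1) ∧
    ∀ x, γ x = (1 / 2 + r x * Real.cos (2 * Real.pi * ψ x),
      1 / 2 + r x * Real.sin (2 * Real.pi * ψ x))

/-- `f` is a lift to the real line, with respect to the parametrization `γ`, of the restriction
of `F` to the curve. Being monotone, it witnesses that `F` preserves the cyclic order of points on
the curve. -/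
def IsLiftAlong (θ : ℝ) (γ : ℝ → ℝ × ℝ) (f : CircleDeg1Lift) : Prop :=
  Continuous f ∧ ∀ x, F θ (γ x) = γ (f x)

/-- `Γ` is an `F`-invariant circle in the square which encircles `Z`, on which `F` preserves
the cyclic order of points, and which is invariant under the rotation `R`. -/
structure IsRotSymInvariantCircle (θ : ℝ) (Γ : Set (ℝ × ℝ)) : Prop where
  subset : Γ ⊆ square
  invariant : F θ '' Γ = Γ
  order : ∃ γ f, IsCcwParam Γ γ ∧ IsLiftAlong θ γ f
  symmetric : rot '' Γ = Γ

/-- The circle homeomorphism `F|Γ` has rotation number `ρ`, where rotation numbers, which are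
determined modulo `1`, are represented in `[0, 1)`. -/
def HasRotationNumber (θ : ℝ) (Γ : Set (ℝ × ℝ)) (ρ : ℝ) : Prop :=
  0 ≤ ρ ∧ ρ < 1 ∧ ∃ γ f, IsCcwParam Γ γ ∧ IsLiftAlong θ γ f ∧
    ∃ m : ℤ, f.translationNumber = ρ + m

/-- The sets `Γ τ`, `τ ∈ [0,1]`, are the leaves of a foliation of `A` by circles: some homeomorphism
of the product of the circle and `[0,1]` onto `A` maps the circles at height `τ` onto `Γ τ`.
(A continuous injection of a compact space into the plane is a homeomorphism onto its range.) -/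
def IsCircleFoliation (A : Set (ℝ × ℝ)) (Γ : unitInterval → Set (ℝ × ℝ)) : Prop :=
  ∃ h : UnitAddCircle × unitInterval → ℝ × ℝ, Continuous h ∧ Function.Injective h ∧
    range h = A ∧ ∀ τ, Γ τ = h '' (univ ×ˢ {τ})

end

end SquareMap

open SquareMap

/-!
Write `s = sc θ`, `t = tc θ`. On the triangle `A 0` the map `F` is a horizontal shear, on the
triangle `B 0` it is the hyperbolic linear map `mapB θ` of determinant `1`, and everything
commutes with the rotation `rot`. For a special parameter, the points `vert θ i = F^i (P 3)`,
`i ≤ K`, run in `B 0` from `P 3` to `P 0 = rot (P 3)`. The first edge of this polygon is vertical, the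
edge following the last one is horizontal, and since `mapB θ` has determinant `1` and trace at
least `2`, every vertex lies beyond the line through any edge, as seen from `E 0`
(`one_le_edgeForm_vert`). Together with its rotates, the polygon is the convex curve `Gamma0 θ K`,
on which `F` maps each edge affinely to the next.

The leaf at height `l ∈ [0,1]` consists, up to rotation, of the polygon scaled by `l` towards the
vertex `E 0` and of a horizontal segment of length `1 - l` in `A 0` (`arc`, `leaf`). Let each
scaled edge have measure `l`, and let the measure on the horizontal segment be the length divided
by `1 - 2s`. The shear moves points at height `l * t` by `l * (1 - 2s)`, which is also the length
of the adjacent scaled edges. Hence `F` translates by `l` (`F_arc`) on a curve whose quarters have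
measure `quarter θ K l = K l + (1 - l) / (1 - 2s)`, and in a parametrization with period `1` it is
the rotation by `l / (4 * quarter θ K l)` (`F_leaf`). This number increases from `0` to
`1 / (4K)`.

That the leaves foliate the annulus follows from a description of them as level sets: let `height`
be the minimum of the linear forms which are `1` on the edges of the polygon (`edgeForm`), over
all rotates. This is a concave function, the square is `{0 ≤ height}`, the leaf at height `l` is
`{height = l}` (`range_leaf`: the polar angle along the leaf takes all values, and by concavity a
ray from the centre meets a level set only once), and the component of the centre in the
complement of `Gamma0` is the star-shaped open set `{1 < height}` (`annulus_eq`).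

Special parameters exist by the intermediate value theorem. In the basis `P 0`, `P 3` the second
coordinate of `vert θ K` satisfies a linear recursion whose coefficient is the trace of `mapB θ`,
and `θ` is special once this coordinate vanishes (`isSpecialParameter_of_recSeq_eq_zero`). It
tends to `1` as `θ → π/4`, it is negative at `θ = arctan (1/4)` for all `K ≥ 3`, and for each
fixed `θ` it is negative for all large `K`; the last fact gives the convergence to `π/4`.
-/

open Set Filter Topology

namespace SquareMap

noncomputable section

/-! ### The map `F` on the pieces `A i` and `B i` -/

theorem sc_lt_half {θ : ℝ} (h0 : 0 < θ) (h1 : θ < Real.pi / 4) : sc θ < 1 / 2 := by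
  have ht := tc_pos h0 h1
  have hts := tc_lt_sc h0 h1
  nlinarith [sc_sq θ]

theorem continuous_rot : Continuous rot := by
  unfold rot; fun_prop

theorem rot_iterate_mod (n : ℕ) (p : ℝ × ℝ) : rot^[n % 4] p = rot^[n] p :=
  Function.IsPeriodicPt.iterate_mod_apply (rot_four p) n

theorem rot_iterate_comb (i : ℕ) {a b c : ℝ} (h : a + b + c = 1) (p q r : ℝ × ℝ) :
    rot^[i] (a • p + b • q + c • r) = a • rot^[i] p + b • rot^[i] q + c • rot^[i] r := by
  induction i with
  | zero => rfl
  | succ i ih =>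
    simp only [Function.iterate_succ_apply', ih]
    ext <;> simp only [rot, Prod.fst_add, Prod.snd_add, Prod.smul_fst, Prod.smul_snd, smul_eq_mul]
    linear_combination -h

theorem mem_convexHull_triple {E : Type*} [AddCommGroup E] [Module ℝ E] {x y z p : E} :
    p ∈ convexHull ℝ {x, y, z} ↔
      ∃ a b c : ℝ, 0 ≤ a ∧ 0 ≤ b ∧ 0 ≤ c ∧ a + b + c = 1 ∧ p = a • x + b • y + c • z := by
  rw [convexHull_insert ⟨y, by simp⟩, convexHull_pair, convexJoin_singleton_left]
  simp only [mem_iUnion, segment, mem_ofPred_eq, exists_prop]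
  constructor
  · rintro ⟨q, ⟨b, c, hb, hc, hbc, rfl⟩, a, d, ha, hd, had, rfl⟩
    refine ⟨a, d * b, d * c, ha, mul_nonneg hd hb, mul_nonneg hd hc, ?_, ?_⟩
    · linear_combination had + d * hbc
    · module
  · rintro ⟨a, b, c, ha, hb, hc, habc, rfl⟩
    rcases (add_nonneg hb hc).eq_or_lt with h | h
    · have hb' : b = 0 := by linarith
      have hc' : c = 0 := by linarith
      refine ⟨y, ⟨1, 0, by simp⟩, a, 0, ha, le_rfl, by linarith, by simp [hb', hc']⟩
    · refine ⟨(b / (b + c)) • y + (c / (b + c)) • z, ⟨_, _, by positivity, by positivity, ?_, rfl⟩,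
        a, b + c, ha, h.le, by linarith, ?_⟩
      · field_simp
      · rw [smul_add, smul_smul, smul_smul, mul_div_cancel₀ _ h.ne', mul_div_cancel₀ _ h.ne',
          add_assoc]

/-- The points of `pieceA θ 0`, in the barycentric coordinates of `E 1` and `P θ 0`. -/
theorem mem_pieceA_zero {θ : ℝ} {p : ℝ × ℝ} : p ∈ pieceA θ 0 ↔
    ∃ a b : ℝ, 0 ≤ a ∧ 0 ≤ b ∧ a + b ≤ 1 ∧ p = (a + b * sc θ, b * tc θ) := by
  simp only [pieceA, mem_convexHull_triple, E, P, Function.iterate_zero, id, zero_add,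
    Function.iterate_one, rot]
  constructor
  · rintro ⟨a, b, c, ha, hb, hc, h, rfl⟩
    exact ⟨b, c, hb, hc, by linarith, by ext <;> simp⟩
  · rintro ⟨a, b, ha, hb, h, rfl⟩
    exact ⟨1 - a - b, a, b, by linarith, ha, hb, by ring, by ext <;> simp⟩

/-- The points of `pieceB θ 0`, in the barycentric coordinates of `P θ 0` and `P θ 3`. -/
theorem mem_pieceB_zero {θ : ℝ} {p : ℝ × ℝ} : p ∈ pieceB θ 0 ↔
    ∃ a b : ℝ, 0 ≤ a ∧ 0 ≤ b ∧ a + b ≤ 1 ∧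
      p = (a * sc θ + b * tc θ, a * tc θ + b * (1 - sc θ)) := by
  simp only [pieceB, mem_convexHull_triple, E, P, Function.iterate_zero, id, zero_add,
    Function.iterate_succ, Function.comp_apply, rot]
  constructor
  · rintro ⟨a, b, c, ha, hb, hc, h, rfl⟩
    exact ⟨b, c, hb, hc, by linarith, by ext <;> simp⟩
  · rintro ⟨a, b, ha, hb, h, rfl⟩
    exact ⟨1 - a - b, a, b, by linarith, ha, hb, by ring, by ext <;> simp⟩

theorem mem_pieceA_iff {θ : ℝ} {i : ℕ} {p : ℝ × ℝ} :
    p ∈ pieceA θ i ↔ ∃ q ∈ pieceA θ 0, p = rot^[i] q := by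
  simp only [pieceA, mem_convexHull_triple]
  have e1 : E i = rot^[i] (E 0) := rfl
  have e2 : E (i + 1) = rot^[i] (E 1) := by simp only [E, Function.iterate_add_apply]
  have e3 : P θ i = rot^[i] (P θ 0) := rfl
  constructor
  · rintro ⟨a, b, c, ha, hb, hc, h, rfl⟩
    exact ⟨_, ⟨a, b, c, ha, hb, hc, h, rfl⟩, by rw [rot_iterate_comb i h, e1, e2, e3, zero_add]⟩
  · rintro ⟨_, ⟨a, b, c, ha, hb, hc, h, rfl⟩, rfl⟩
    exact ⟨a, b, c, ha, hb, hc, h, by rw [rot_iterate_comb i h, e1, e2, e3, zero_add]⟩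

theorem mem_pieceB_iff {θ : ℝ} {i : ℕ} {p : ℝ × ℝ} :
    p ∈ pieceB θ i ↔ ∃ q ∈ pieceB θ 0, p = rot^[i] q := by
  simp only [pieceB, mem_convexHull_triple]
  have e1 : E i = rot^[i] (E 0) := rfl
  have e2 : P θ (i + 3) = rot^[i] (P θ 3) := by simp only [P, Function.iterate_add_apply]
  have e3 : P θ i = rot^[i] (P θ 0) := rfl
  constructor
  · rintro ⟨a, b, c, ha, hb, hc, h, rfl⟩
    exact ⟨_, ⟨a, b, c, ha, hb, hc, h, rfl⟩, by rw [rot_iterate_comb i h, e1, e2, e3, zero_add]⟩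
  · rintro ⟨_, ⟨a, b, c, ha, hb, hc, h, rfl⟩, rfl⟩
    exact ⟨a, b, c, ha, hb, hc, h, by rw [rot_iterate_comb i h, e1, e2, e3, zero_add]⟩

/-- The rotates of two maps, defined on the rotates of two sets, agree wherever both are defined. -/
def RotCompat (S T : Set (ℝ × ℝ)) (f g : ℝ × ℝ → ℝ × ℝ) : Prop :=
  ∀ k < 4, ∀ p ∈ S, ∀ q ∈ T, p = rot^[k] q → f p = rot^[k] (g q)

theorem RotCompat.eq {S T : Set (ℝ × ℝ)} {f g : ℝ × ℝ → ℝ × ℝ} (h : RotCompat S T f g)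
    {i j : ℕ} (hi : i < 4) {p q : ℝ × ℝ} (hp : p ∈ S) (hq : q ∈ T)
    (hpq : rot^[i] p = rot^[j] q) : rot^[i] (f p) = rot^[j] (g q) := by
  have key : p = rot^[(4 - i + j) % 4] q := by
    rw [rot_iterate_mod, Function.iterate_add_apply, ← hpq, ← Function.iterate_add_apply,
      Nat.sub_add_cancel hi.le, rot_four]
  rw [h _ (Nat.mod_lt _ (by norm_num)) p hp q hq key, rot_iterate_mod, ← Function.iterate_add_apply,
    ← add_assoc, Nat.add_sub_cancel' hi.le, Function.iterate_add_apply, rot_four]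

theorem RotCompat.symm {S T : Set (ℝ × ℝ)} {f g : ℝ × ℝ → ℝ × ℝ} (h : RotCompat S T f g) :
    RotCompat T S g f := fun _ hk _ hp _ hq hpq =>
  (h.eq hk hq hp (j := 0) hpq.symm).symm

theorem turn_rot_iterate {i : ℕ} (hi : i ≤ 4) (f : ℝ × ℝ → ℝ × ℝ) (p : ℝ × ℝ) :
    turn i f (rot^[i] p) = rot^[i] (f p) := by
  rw [turn, ← Function.iterate_add_apply, Nat.sub_add_cancel hi, rot_four]

theorem rotCompat_A_A {θ : ℝ} (h0 : 0 < θ) (h1 : θ < Real.pi / 4) :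
    RotCompat (pieceA θ 0) (pieceA θ 0) (mapA θ) (mapA θ) := by
  have ht := tc_pos h0 h1
  have hts := tc_lt_sc h0 h1
  have hs := sc_lt_half h0 h1
  intro k hk p hp q hq hpq
  obtain ⟨a, b, ha, hb, hab, rfl⟩ := mem_pieceA_zero.1 hp
  obtain ⟨c, d, hc, hd, hcd, rfl⟩ := mem_pieceA_zero.1 hq
  interval_cases k
  · simp only [Function.iterate_zero, id] at hpq ⊢
    rw [hpq]
  · simp only [Function.iterate_one, rot, Prod.mk.injEq] at hpq
    have hb0 : b = 0 := by nlinarith [mul_nonneg hb ht.le, mul_nonneg hd ht.le]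
    have hd0 : d = 0 := by subst hb0; nlinarith [mul_nonneg hb ht.le, mul_nonneg hd ht.le]
    subst hb0 hd0
    simp only [Function.iterate_one, mapA, rot, Prod.mk.injEq]
    constructor <;> linarith [hpq.1, hpq.2]
  · exfalso
    simp only [Function.iterate_succ, Function.iterate_zero, Function.comp_apply, id, rot,
      Prod.mk.injEq] at hpq
    nlinarith [mul_nonneg hb ht.le, mul_nonneg hd ht.le]
  · simp only [Function.iterate_succ, Function.iterate_zero, Function.comp_apply, id, rot,
      Prod.mk.injEq] at hpq
    have hd0 : d = 0 := by nlinarith [mul_nonneg hb ht.le, mul_nonneg hd ht.le]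
    have hb0 : b = 0 := by subst hd0; nlinarith [mul_nonneg hb ht.le, mul_nonneg hd ht.le]
    subst hb0 hd0
    simp only [Function.iterate_succ, Function.iterate_zero, Function.comp_apply, id, mapA, rot,
      Prod.mk.injEq]
    constructor <;> linarith [hpq.1, hpq.2]

theorem mapB_smul (θ c : ℝ) (p : ℝ × ℝ) : mapB θ (c • p) = c • mapB θ p := by
  ext <;> simp only [mapB, Prod.smul_fst, Prod.smul_snd, smul_eq_mul] <;> ring

theorem mapB_add (θ : ℝ) (p q : ℝ × ℝ) : mapB θ (p + q) = mapB θ p + mapB θ q := by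
  ext <;> simp only [mapB, Prod.fst_add, Prod.snd_add] <;> ring

theorem mapB_sub (θ : ℝ) (p q : ℝ × ℝ) : mapB θ (p - q) = mapB θ p - mapB θ q := by
  ext <;> simp only [mapB, Prod.fst_sub, Prod.snd_sub] <;> ring

theorem P_three (θ : ℝ) : P θ 3 = (tc θ, 1 - sc θ) := by
  simp [P, rot]

theorem P'_three (θ : ℝ) : P' θ 3 = (tc θ, sc θ) := by
  simp [P', rot]

theorem mapB_coord {θ : ℝ} (h0 : 0 < θ) (h1 : θ < Real.pi / 4) (a b : ℝ) :
    mapB θ (a * sc θ + b * tc θ, a * tc θ + b * (1 - sc θ)) =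
      (a * (1 - sc θ) + b * tc θ, a * tc θ + b * sc θ) := by
  obtain ⟨-, hB0, hB3⟩ := mapB_vertices h0 h1
  have e : ((a * sc θ + b * tc θ, a * tc θ + b * (1 - sc θ)) : ℝ × ℝ) =
      a • P θ 0 + b • P θ 3 := by rw [P_three]; ext <;> simp [P]
  rw [e, mapB_add, mapB_smul, mapB_smul, hB0, hB3, P'_three]
  ext <;> simp [P']

theorem mapA_coord {θ : ℝ} (h0 : 0 < θ) (h1 : θ < Real.pi / 4) (a b : ℝ) :
    mapA θ (a, b * tc θ) = (a + b * (1 - 2 * sc θ), b * tc θ) := by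
  have ht := (tc_pos h0 h1).ne'
  simp only [mapA, Prod.mk.injEq, and_true]
  field_simp

theorem rotCompat_B_A {θ : ℝ} (h0 : 0 < θ) (h1 : θ < Real.pi / 4) :
    RotCompat (pieceB θ 0) (pieceA θ 0) (mapB θ) (mapA θ) := by
  have ht := tc_pos h0 h1
  have hts := tc_lt_sc h0 h1
  have hs := sc_lt_half h0 h1
  have hss := sc_sq θ
  intro k hk p hp q hq hpq
  obtain ⟨a, b, ha, hb, hab, rfl⟩ := mem_pieceB_zero.1 hp
  obtain ⟨c, d, hc, hd, hcd, rfl⟩ := mem_pieceA_zero.1 hq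
  rw [mapB_coord h0 h1, mapA_coord h0 h1]
  have m1 := mul_nonneg ha (sub_pos.2 hts).le
  have m2 := mul_nonneg hb (sub_pos.2 hts).le
  have m3 := mul_nonneg hc ht.le
  have m4 := mul_nonneg hd ht.le
  interval_cases k
  · simp only [Function.iterate_zero, id, Prod.mk.injEq] at hpq ⊢
    obtain ⟨e1, e2⟩ := hpq
    -- the barycentric coordinate of `E 1` in `A` and that of `P 3` in `B` have opposite signs
    have hdet : b * (tc θ - sc θ) = c * tc θ := by
      linear_combination tc θ * e1 - sc θ * e2 - b * hss
    have hb0 : b = 0 := by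
      by_contra hne
      have : 0 < b * (sc θ - tc θ) := mul_pos (lt_of_le_of_ne hb (Ne.symm hne)) (by linarith)
      linarith
    subst hb0
    have hc0 : c = 0 := by
      have : c * tc θ = 0 := by linarith
      exact (mul_eq_zero.1 this).resolve_right ht.ne'
    subst hc0
    have : a = d := mul_right_cancel₀ ht.ne' (by linarith)
    subst this
    constructor <;> ring
  · exfalso
    simp only [Function.iterate_one, rot, Prod.mk.injEq] at hpq
    nlinarith
  · exfalso
    simp only [Function.iterate_succ, Function.iterate_zero, Function.comp_apply, id, rot,
      Prod.mk.injEq] at hpq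
    nlinarith [mul_nonneg ha ht.le, mul_nonneg hb ht.le]
  · simp only [Function.iterate_succ, Function.iterate_zero, Function.comp_apply, id, rot,
      Prod.mk.injEq] at hpq ⊢
    obtain ⟨e1, e2⟩ := hpq
    -- compare positions relative to the ray from the origin through `P 3`
    have hdet : a * (sc θ - tc θ) + (1 - c - d) * tc θ = 0 := by
      linear_combination (1 - sc θ) * e1 - tc θ * e2 + a * hss
    have m5 : 0 ≤ (1 - c - d) * tc θ := mul_nonneg (by linarith) ht.le
    have ha0 : a = 0 := by
      by_contra hne
      have : 0 < a * (sc θ - tc θ) := mul_pos (lt_of_le_of_ne ha (Ne.symm hne)) (by linarith)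
      linarith
    subst ha0
    have hc0 : c = 1 - d := by
      have : (1 - c - d) * tc θ = 0 := by linarith
      linarith [(mul_eq_zero.1 this).resolve_right ht.ne']
    subst hc0
    have : b = d := mul_right_cancel₀ ht.ne' (by linarith)
    subst this
    constructor <;> ring

theorem rotCompat_B_B {θ : ℝ} (h0 : 0 < θ) (h1 : θ < Real.pi / 4) :
    RotCompat (pieceB θ 0) (pieceB θ 0) (mapB θ) (mapB θ) := by
  have ht := tc_pos h0 h1
  have hts := tc_lt_sc h0 h1
  have hs := sc_lt_half h0 h1
  intro k hk p hp q hq hpq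
  obtain ⟨a, b, ha, hb, hab, rfl⟩ := mem_pieceB_zero.1 hp
  obtain ⟨c, d, hc, hd, hcd, rfl⟩ := mem_pieceB_zero.1 hq
  rw [mapB_coord h0 h1, mapB_coord h0 h1]
  have m1 := mul_nonneg hb (sub_pos.2 hts).le
  have m2 := mul_nonneg hc (sub_pos.2 hts).le
  have m3 := mul_nonneg (sub_nonneg.2 hab) (ht.trans hts).le
  have m4 := mul_nonneg (sub_nonneg.2 hcd) (ht.trans hts).le
  have m5 := mul_nonneg (sub_nonneg.2 hab) (by linarith : 0 ≤ 1 - sc θ)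
  have m6 := mul_nonneg (sub_nonneg.2 hcd) (by linarith : 0 ≤ 1 - sc θ)
  have m7 := mul_nonneg ha (by linarith : 0 ≤ 1 - sc θ - tc θ)
  have m8 := mul_nonneg hc (by linarith : 0 ≤ 1 - sc θ - tc θ)
  interval_cases k
  · simp only [Function.iterate_zero, id, Prod.mk.injEq] at hpq ⊢
    obtain ⟨e1, e2⟩ := hpq
    have e3 : b * (sc θ - tc θ) = d * (sc θ - tc θ) := by
      linear_combination sc θ * e2 - tc θ * e1 + (b - d) * sc_sq θ
    have e4 : b = d := mul_right_cancel₀ (by linarith : sc θ - tc θ ≠ 0) e3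
    subst e4
    have e5 : a = c := mul_right_cancel₀ ht.ne' (by linarith)
    subst e5
    simp
  · simp only [Function.iterate_one, rot, Prod.mk.injEq] at hpq ⊢
    obtain ⟨e1, e2⟩ := hpq
    have hb0 : b = 0 := by
      by_contra hne
      have : 0 < b * (sc θ - tc θ) := mul_pos (lt_of_le_of_ne hb (Ne.symm hne)) (by linarith)
      nlinarith
    subst hb0
    have ha1 : a = 1 := mul_right_cancel₀ (ht.trans hts).ne' (by nlinarith)
    subst ha1
    have hc0 : c = 0 := by
      by_contra hne
      have : 0 < c * (1 - sc θ - tc θ) :=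
        mul_pos (lt_of_le_of_ne hc (Ne.symm hne)) (by linarith)
      nlinarith
    subst hc0
    have hd1 : d = 1 := mul_right_cancel₀ ht.ne' (by linarith)
    subst hd1
    constructor <;> ring
  · exfalso
    simp only [Function.iterate_succ, Function.iterate_zero, Function.comp_apply, id, rot,
      Prod.mk.injEq] at hpq
    nlinarith
  · simp only [Function.iterate_succ, Function.iterate_zero, Function.comp_apply, id, rot,
      Prod.mk.injEq] at hpq ⊢
    obtain ⟨e1, e2⟩ := hpq
    have m9 := mul_nonneg hd (sub_pos.2 hts).le
    have hd0 : d = 0 := by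
      by_contra hne
      have : 0 < d * (sc θ - tc θ) := mul_pos (lt_of_le_of_ne hd (Ne.symm hne)) (by linarith)
      nlinarith
    subst hd0
    have hc1 : c = 1 := mul_right_cancel₀ (ht.trans hts).ne' (by nlinarith)
    subst hc1
    have ha0 : a = 0 := by
      by_contra hne
      have : 0 < a * (1 - sc θ - tc θ) :=
        mul_pos (lt_of_le_of_ne ha (Ne.symm hne)) (by linarith)
      nlinarith
    subst ha0
    have hb1 : b = 1 := mul_right_cancel₀ ht.ne' (by linarith)
    subst hb1
    constructor <;> ring

/-- To determine `F θ p` it suffices to look at all the triangles that contain `p`. -/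
theorem F_eq_of {θ : ℝ} {p q : ℝ × ℝ}
    (hA : ∀ i < 4, p ∈ pieceA θ i → turn i (mapA θ) p = q)
    (hB : ∀ i < 4, p ∈ pieceB θ i → turn i (mapB θ) p = q)
    (hex : ∃ i < 4, p ∈ pieceA θ i ∨ p ∈ pieceB θ i) : F θ p = q := by
  have e : ∀ f, turn 0 f p = f p := fun f => turn_rot_iterate (i := 0) (by norm_num) f p
  unfold F
  split_ifs with a0 a1 a2 a3 b0 b1 b2 b3 c
  · rw [← hA 0 (by norm_num) a0, e]
  · exact hA 1 (by norm_num) a1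
  · exact hA 2 (by norm_num) a2
  · exact hA 3 (by norm_num) a3
  · rw [← hB 0 (by norm_num) b0, e]
  · exact hB 1 (by norm_num) b1
  · exact hB 2 (by norm_num) b2
  · exact hB 3 (by norm_num) b3
  all_goals
    exfalso
    obtain ⟨i, hi, hp⟩ := hex
    interval_cases i <;> tauto

theorem F_rot_A {θ : ℝ} (h0 : 0 < θ) (h1 : θ < Real.pi / 4) {i : ℕ} (hi : i < 4) {p : ℝ × ℝ}
    (hp : p ∈ pieceA θ 0) : F θ (rot^[i] p) = rot^[i] (mapA θ p) := by
  apply F_eq_of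
  · intro j hj h
    obtain ⟨q, hq, e⟩ := mem_pieceA_iff.1 h
    rw [e, turn_rot_iterate hj.le]
    exact ((rotCompat_A_A h0 h1).eq hi hp hq e).symm
  · intro j hj h
    obtain ⟨q, hq, e⟩ := mem_pieceB_iff.1 h
    rw [e, turn_rot_iterate hj.le]
    exact ((rotCompat_B_A h0 h1).symm.eq hi hp hq e).symm
  · exact ⟨i, hi, .inl (mem_pieceA_iff.2 ⟨p, hp, rfl⟩)⟩

theorem F_rot_B {θ : ℝ} (h0 : 0 < θ) (h1 : θ < Real.pi / 4) {i : ℕ} (hi : i < 4) {p : ℝ × ℝ}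
    (hp : p ∈ pieceB θ 0) : F θ (rot^[i] p) = rot^[i] (mapB θ p) := by
  apply F_eq_of
  · intro j hj h
    obtain ⟨q, hq, e⟩ := mem_pieceA_iff.1 h
    rw [e, turn_rot_iterate hj.le]
    exact ((rotCompat_B_A h0 h1).eq hi hp hq e).symm
  · intro j hj h
    obtain ⟨q, hq, e⟩ := mem_pieceB_iff.1 h
    rw [e, turn_rot_iterate hj.le]
    exact ((rotCompat_B_B h0 h1).eq hi hp hq e).symm
  · exact ⟨i, hi, .inr (mem_pieceB_iff.2 ⟨p, hp, rfl⟩)⟩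

theorem F_rot_iterate {θ : ℝ} (h0 : 0 < θ) (h1 : θ < Real.pi / 4) (i : ℕ) {p : ℝ × ℝ}
    (hp : p ∈ pieceA θ 0 ∪ pieceB θ 0) : F θ (rot^[i] p) = rot^[i] (F θ p) := by
  rw [← rot_iterate_mod i, ← rot_iterate_mod i]
  have hi : i % 4 < 4 := Nat.mod_lt _ (by norm_num)
  rcases hp with hp | hp
  · rw [F_rot_A h0 h1 hi hp]
    exact congrArg _ (F_rot_A h0 h1 (i := 0) (by norm_num) hp).symm
  · rw [F_rot_B h0 h1 hi hp]
    exact congrArg _ (F_rot_B h0 h1 (i := 0) (by norm_num) hp).symm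

theorem F_of_mem_A {θ : ℝ} (h0 : 0 < θ) (h1 : θ < Real.pi / 4) {p : ℝ × ℝ}
    (hp : p ∈ pieceA θ 0) : F θ p = mapA θ p := F_rot_A h0 h1 (i := 0) (by norm_num) hp

theorem F_of_mem_B {θ : ℝ} (h0 : 0 < θ) (h1 : θ < Real.pi / 4) {p : ℝ × ℝ}
    (hp : p ∈ pieceB θ 0) : F θ p = mapB θ p := F_rot_B h0 h1 (i := 0) (by norm_num) hp

/-! ### The orbit of `P 3` in the triangle `B 0` -/

/-- The trace of the linear map `mapB θ`, whose determinant is `1`. -/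
def traceB (θ : ℝ) : ℝ := 2 + (1 - 2 * sc θ) ^ 2 / (sc θ - tc θ)

/-- The orbit of `P 3` under the linear map `mapB θ`. -/
def vert (θ : ℝ) (i : ℕ) : ℝ × ℝ := (mapB θ)^[i] (P θ 3)

/-- The edges of the polygon with vertices `vert θ i`. -/
def edge (θ : ℝ) (i : ℕ) : ℝ × ℝ := vert θ (i + 1) - vert θ i

theorem two_le_traceB {θ : ℝ} (h0 : 0 < θ) (h1 : θ < Real.pi / 4) : 2 ≤ traceB θ := by
  have := sub_pos.2 (tc_lt_sc h0 h1)
  unfold traceB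
  have : 0 ≤ (1 - 2 * sc θ) ^ 2 / (sc θ - tc θ) := by positivity
  linarith

/-- The Cayley–Hamilton theorem for `mapB θ`. -/
theorem mapB_mapB {θ : ℝ} (h0 : 0 < θ) (h1 : θ < Real.pi / 4) (p : ℝ × ℝ) :
    mapB θ (mapB θ p) = traceB θ • mapB θ p - p := by
  have h : sc θ - tc θ ≠ 0 := (sub_pos.2 (tc_lt_sc h0 h1)).ne'
  have h' : tc θ - sc θ ≠ 0 := (sub_neg.2 (tc_lt_sc h0 h1)).ne
  have hs := sc_sq θ
  obtain ⟨x, y⟩ := p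
  have hd : tc θ - sc θ = -(sc θ - tc θ) := by ring
  have e : traceB θ = (4 * tc θ ^ 2 - 2 * tc θ - 1 + 2 * sc θ) / (tc θ - sc θ) := by
    rw [traceB, hd, eq_div_iff (neg_ne_zero.2 h)]
    field_simp
    linear_combination (-4) * hs
  ext
  · simp only [mapB, e, Prod.fst_sub, Prod.smul_fst, smul_eq_mul]
    field_simp
    grind
  · simp only [mapB, e, Prod.snd_sub, Prod.smul_snd, smul_eq_mul]
    field_simp
    grind

theorem det_mapB {θ : ℝ} (h0 : 0 < θ) (h1 : θ < Real.pi / 4) (p q : ℝ × ℝ) :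
    (mapB θ p).1 * (mapB θ q).2 - (mapB θ p).2 * (mapB θ q).1 = p.1 * q.2 - p.2 * q.1 := by
  have h' : tc θ - sc θ ≠ 0 := (sub_neg.2 (tc_lt_sc h0 h1)).ne
  have hs := sc_sq θ
  simp only [mapB]
  field_simp
  grind

/-- The reflection in the diagonal conjugates `mapB θ` to its inverse. -/
theorem mapB_swap_mapB {θ : ℝ} (h0 : 0 < θ) (h1 : θ < Real.pi / 4) (p : ℝ × ℝ) :
    mapB θ (mapB θ p).swap = p.swap := by
  have h' : tc θ - sc θ ≠ 0 := (sub_neg.2 (tc_lt_sc h0 h1)).ne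
  have hs := sc_sq θ
  obtain ⟨x, y⟩ := p
  ext
  · simp only [mapB, Prod.fst_swap, Prod.snd_swap]
    field_simp
    grind
  · simp only [mapB, Prod.fst_swap, Prod.snd_swap]
    field_simp
    grind

theorem vert_zero (θ : ℝ) : vert θ 0 = (tc θ, 1 - sc θ) := P_three θ

theorem vert_one {θ : ℝ} (h0 : 0 < θ) (h1 : θ < Real.pi / 4) : vert θ 1 = (tc θ, sc θ) :=
  (mapB_vertices h0 h1).2.2.trans (P'_three θ)

theorem vert_succ (θ : ℝ) (i : ℕ) : vert θ (i + 1) = mapB θ (vert θ i) :=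
  Function.iterate_succ_apply' _ _ _

theorem edge_succ (θ : ℝ) (i : ℕ) : edge θ (i + 1) = mapB θ (edge θ i) := by
  rw [edge, edge, mapB_sub, ← vert_succ, ← vert_succ]

theorem edge_zero {θ : ℝ} (h0 : 0 < θ) (h1 : θ < Real.pi / 4) :
    edge θ 0 = (0, -(1 - 2 * sc θ)) := by
  rw [edge, vert_one h0 h1, vert_zero]
  ext <;> simp
  ring

theorem vert_rec {θ : ℝ} (h0 : 0 < θ) (h1 : θ < Real.pi / 4) (i : ℕ) :
    vert θ (i + 2) = traceB θ • vert θ (i + 1) - vert θ i := by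
  rw [vert_succ, vert_succ, mapB_mapB h0 h1]

theorem edge_rec {θ : ℝ} (h0 : 0 < θ) (h1 : θ < Real.pi / 4) (i : ℕ) :
    edge θ (i + 2) = traceB θ • edge θ (i + 1) - edge θ i := by
  rw [edge_succ, edge_succ, mapB_mapB h0 h1]

/-- Solutions of `x (i+2) = τ x (i+1) - x i` with `τ ≥ 2` that are nonnegative and increasing at
the start remain so. -/
theorem rec_monotone {τ : ℝ} (hτ : 2 ≤ τ) {x : ℕ → ℝ} (hx : ∀ i, x (i + 2) = τ * x (i + 1) - x i)
    (n : ℕ) (hn : 0 ≤ x n) (hn1 : x n ≤ x (n + 1)) (i : ℕ) :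
    0 ≤ x (n + i) ∧ x (n + i) ≤ x (n + i + 1) := by
  induction i with
  | zero => exact ⟨hn, hn1⟩
  | succ i ih =>
    have h := hx (n + i)
    rw [show n + (i + 1) = n + i + 1 by ring]
    have := ih.1.trans ih.2
    exact ⟨this, by nlinarith [ih.2]⟩

/-- A solution of the recursion that takes the value `1` at two successive indices is at least `1`
everywhere. -/
theorem one_le_of_rec {τ : ℝ} (hτ : 2 ≤ τ) {x : ℕ → ℝ}
    (hx : ∀ i, x (i + 2) = τ * x (i + 1) - x i) (n : ℕ) (hn : x n = 1) (hn1 : x (n + 1) = 1)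
    (i : ℕ) : 1 ≤ x i := by
  rcases le_total n i with h | h
  · obtain ⟨j, rfl⟩ := Nat.exists_eq_add_of_le h
    have key : ∀ j, 1 ≤ x (n + j) ∧ x (n + j) ≤ x (n + j + 1) := by
      intro j
      induction j with
      | zero => exact ⟨hn.ge, by rw [Nat.add_zero, hn, hn1]⟩
      | succ j ih =>
        have h := hx (n + j)
        rw [show n + (j + 1) = n + j + 1 by ring]
        exact ⟨ih.1.trans ih.2, by nlinarith [ih.1, ih.2]⟩
    exact (key j).1
  · have key : ∀ j ≤ n, 1 ≤ x (n - j) ∧ x (n - j + 1) ≤ x (n - j) := by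
      intro j hj
      induction j with
      | zero => exact ⟨hn.ge, by rw [Nat.sub_zero, hn, hn1]⟩
      | succ j ih =>
        obtain ⟨i1, i2⟩ := ih (by omega)
        obtain ⟨m, hm⟩ : ∃ m, n - j = m + 1 := ⟨n - j - 1, by omega⟩
        have h := hx m
        rw [show n - (j + 1) = m by omega]
        rw [hm] at i1 i2
        have : x (m + 1) ≤ x m := by nlinarith
        exact ⟨i1.trans this, this⟩
    have := (key (n - i) (Nat.sub_le _ _)).1
    rwa [Nat.sub_sub_self h] at this

theorem edge_fst_mono {θ : ℝ} (h0 : 0 < θ) (h1 : θ < Real.pi / 4) (i : ℕ) :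
    0 ≤ (edge θ i).1 ∧ 0 < (edge θ (i + 1)).1 := by
  have ht := tc_pos h0 h1
  have hst := sub_pos.2 (tc_lt_sc h0 h1)
  have hs := sc_lt_half h0 h1
  have hb : 0 < 1 - 2 * sc θ := by linarith
  have hτ := two_le_traceB h0 h1
  have hrec : ∀ i, (edge θ (i + 2)).1 = traceB θ * (edge θ (i + 1)).1 - (edge θ i).1 := by
    intro i
    rw [edge_rec h0 h1]
    simp
  have e0 : (edge θ 0).1 = 0 := by rw [edge_zero h0 h1]
  have e1 : 0 < (edge θ 1).1 := by
    rw [edge_succ, edge_zero h0 h1]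
    have : (mapB θ (0, -(1 - 2 * sc θ))).1 = (1 - 2 * sc θ) ^ 2 * tc θ / (sc θ - tc θ) := by
      simp only [mapB]
      rw [show tc θ - sc θ = -(sc θ - tc θ) by ring]
      field_simp
      ring
    rw [this]
    positivity
  have key := fun i =>
    rec_monotone (x := fun i => (edge θ i).1) hτ hrec 0 e0.ge (e0.le.trans e1.le) i
  simp only [zero_add] at key
  refine ⟨(key i).1, ?_⟩
  have key1 : ∀ i, 0 < (edge θ (i + 1)).1 := by
    intro i
    induction i with
    | zero => exact e1
    | succ i ih => exact ih.trans_le (key (i + 1)).2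
  exact key1 i

/-- A scaled determinant of `p` with the edge `edge θ i`: the linear form that is `1` on this
edge. -/
def edgeForm (θ : ℝ) (i : ℕ) (p : ℝ × ℝ) : ℝ :=
  ((edge θ i).1 * p.2 - (edge θ i).2 * p.1) / (tc θ * (1 - 2 * sc θ))

theorem edgeForm_add (θ : ℝ) (i : ℕ) (p q : ℝ × ℝ) :
    edgeForm θ i (p + q) = edgeForm θ i p + edgeForm θ i q := by
  simp only [edgeForm, Prod.fst_add, Prod.snd_add]; ring

theorem edgeForm_smul (θ : ℝ) (i : ℕ) (c : ℝ) (p : ℝ × ℝ) :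
    edgeForm θ i (c • p) = c * edgeForm θ i p := by
  simp only [edgeForm, Prod.smul_fst, Prod.smul_snd, smul_eq_mul]; ring

theorem edgeForm_edge (θ : ℝ) (i : ℕ) : edgeForm θ i (edge θ i) = 0 := by
  rw [edgeForm, mul_comm, sub_self, zero_div]

theorem edgeForm_sub (θ : ℝ) (i : ℕ) (p q : ℝ × ℝ) :
    edgeForm θ i (p - q) = edgeForm θ i p - edgeForm θ i q := by
  simp only [edgeForm, Prod.fst_sub, Prod.snd_sub]; ring

theorem vert_succ_eq (θ : ℝ) (i : ℕ) : vert θ (i + 1) = vert θ i + edge θ i := by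
  rw [edge, add_sub_cancel]

theorem edgeForm_zero {θ : ℝ} (h0 : 0 < θ) (h1 : θ < Real.pi / 4) (p : ℝ × ℝ) :
    edgeForm θ 0 p = p.1 / tc θ := by
  have ht := tc_pos h0 h1
  have hs := sc_lt_half h0 h1
  have : 1 - 2 * sc θ ≠ 0 := by linarith
  rw [edgeForm, edge_zero h0 h1]
  field_simp
  ring

theorem edgeForm_vert_self {θ : ℝ} (h0 : 0 < θ) (h1 : θ < Real.pi / 4) (i : ℕ) :
    edgeForm θ i (vert θ i) = 1 := by
  induction i with
  | zero =>
    rw [edgeForm_zero h0 h1, vert_zero, div_self (tc_pos h0 h1).ne']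
  | succ i ih =>
    rw [← ih, edgeForm, edgeForm, edge_succ, vert_succ, det_mapB h0 h1]

/-- Each vertex lies on the far side of the line through any edge, so that the polygon is
convex. -/
theorem one_le_edgeForm_vert {θ : ℝ} (h0 : 0 < θ) (h1 : θ < Real.pi / 4) (i j : ℕ) :
    1 ≤ edgeForm θ i (vert θ j) := by
  refine one_le_of_rec (two_le_traceB h0 h1) (x := fun j => edgeForm θ i (vert θ j)) ?_ i
    (edgeForm_vert_self h0 h1 i) ?_ j
  · intro j
    simp only [vert_rec h0 h1, edgeForm_sub, edgeForm_smul]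
  · simp only [vert_succ_eq, edgeForm_add, edgeForm_edge, edgeForm_vert_self h0 h1, add_zero]

/-! ### Special parameters -/

theorem IsSpecialParameter.iterate_smul {θ : ℝ} {K : ℕ} (h : IsSpecialParameter K θ) {k : ℕ}
    (hk : k ≤ K) {c : ℝ} (hc0 : 0 ≤ c) (hc1 : c ≤ 1) :
    (F θ)^[k] (c • P θ 3) = c • vert θ k := by
  induction k with
  | zero => rfl
  | succ k ih =>
    have hmem : (F θ)^[k] (c • P θ 3) ∈ pieceB θ 0 :=
      h.mem k hk ⟨_, ⟨1 - c, c, by linarith, hc0, by ring, by ext <;> simp [E]⟩, rfl⟩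
    rw [Function.iterate_succ_apply', F_of_mem_B h.pos h.lt hmem, ih (by omega), mapB_smul,
      vert_succ]

theorem IsSpecialParameter.iterate {θ : ℝ} {K : ℕ} (h : IsSpecialParameter K θ) {k : ℕ}
    (hk : k ≤ K) : (F θ)^[k] (P θ 3) = vert θ k := by
  simpa using h.iterate_smul hk zero_le_one le_rfl

theorem IsSpecialParameter.vert_eq {θ : ℝ} {K : ℕ} (h : IsSpecialParameter K θ) :
    vert θ K = (sc θ, tc θ) := by
  have ht := tc_pos h.pos h.lt
  have e : (F θ)^[K] '' segment ℝ (E 0) (P θ 3) = segment ℝ (E 0) (vert θ K) := by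
    ext p
    simp only [segment, E, Function.iterate_zero, id, mem_image, mem_ofPred_eq]
    constructor
    · rintro ⟨_, ⟨a, b, ha, hb, hab, rfl⟩, rfl⟩
      refine ⟨a, b, ha, hb, hab, ?_⟩
      rw [← h.iterate_smul le_rfl hb (by linarith)]
      simp only [Prod.mk_zero_zero, smul_zero, zero_add]
    · rintro ⟨a, b, ha, hb, hab, rfl⟩
      refine ⟨_, ⟨a, b, ha, hb, hab, rfl⟩, ?_⟩
      have : (a • (0, 0) + b • P θ 3 : ℝ × ℝ) = b • P θ 3 := by ext <;> simp
      rw [this, h.iterate_smul le_rfl hb (by linarith)]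
      ext <;> simp
  have e' := e.symm.trans h.hit
  obtain ⟨a, b, ha, hb, hab, hp⟩ : vert θ K ∈ segment ℝ (E 0) (P θ 0) :=
    e' ▸ right_mem_segment ℝ _ _
  obtain ⟨c, d, hc, hd, hcd, hq⟩ : P θ 0 ∈ segment ℝ (E 0) (vert θ K) :=
    e'.symm ▸ right_mem_segment ℝ _ _
  simp only [E, Function.iterate_zero, id, P] at hp hq
  have hp2 : b * tc θ = (vert θ K).2 := by rw [← hp]; simp
  have hq2 : d * (vert θ K).2 = tc θ := by
    have := congrArg Prod.snd hq
    simpa using this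
  have hdb : d * b = 1 := mul_right_cancel₀ ht.ne' (by linear_combination hq2 + d * hp2)
  have hb1 : b = 1 := by nlinarith
  rw [← hp, hb1]
  ext <;> simp

theorem IsSpecialParameter.vert_mem {θ : ℝ} {K : ℕ} (h : IsSpecialParameter K θ) {k : ℕ}
    (hk : k ≤ K) : vert θ k ∈ pieceB θ 0 := by
  rcases hk.eq_or_lt with rfl | hk
  · rw [h.vert_eq]
    exact subset_convexHull ℝ _ (by simp [P])
  · rw [← h.iterate hk.le]
    exact h.mem k hk ⟨_, right_mem_segment ℝ _ _, rfl⟩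

theorem IsSpecialParameter.edge_eq {θ : ℝ} {K : ℕ} (h : IsSpecialParameter K θ) :
    edge θ K = (1 - 2 * sc θ, 0) := by
  have e : vert θ (K + 1) = (1 - sc θ, tc θ) := by
    rw [vert_succ, h.vert_eq]
    exact (mapB_vertices h.pos h.lt).2.1
  rw [edge, e, h.vert_eq]
  ext <;> simp
  ring

/-- The polygon is symmetric with respect to the diagonal. -/
theorem IsSpecialParameter.edge_swap {θ : ℝ} {K : ℕ} (h : IsSpecialParameter K θ) {i : ℕ}
    (hi : i ≤ K) : (edge θ (K - i)).swap = -edge θ i := by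
  induction i with
  | zero =>
    rw [Nat.sub_zero, h.edge_eq, edge_zero h.pos h.lt]
    ext <;> simp
  | succ i ih =>
    have ih := ih (by omega)
    obtain ⟨m, hm⟩ : ∃ m, K - i = m + 1 := ⟨K - i - 1, by omega⟩
    rw [show K - (i + 1) = m by omega, edge_succ, ← mapB_swap_mapB h.pos h.lt (edge θ m),
      ← edge_succ, ← hm, ih, ← neg_one_smul ℝ (edge θ i), mapB_smul, neg_one_smul]

theorem IsSpecialParameter.edge_snd {θ : ℝ} {K : ℕ} (h : IsSpecialParameter K θ) {i : ℕ}
    (hi : i ≤ K) : (edge θ i).2 = -(edge θ (K - i)).1 := by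
  have := congrArg Prod.snd (h.edge_swap hi)
  simp only [Prod.snd_swap, Prod.snd_neg] at this
  linarith

theorem IsSpecialParameter.edge_snd_nonpos {θ : ℝ} {K : ℕ} (h : IsSpecialParameter K θ) {i : ℕ}
    (hi : i ≤ K) : (edge θ i).2 ≤ 0 := by
  rw [h.edge_snd hi]
  linarith [(edge_fst_mono h.pos h.lt (K - i)).1]

theorem IsSpecialParameter.edge_snd_neg {θ : ℝ} {K : ℕ} (h : IsSpecialParameter K θ) {i : ℕ}
    (hi : i < K) : (edge θ i).2 < 0 := by
  rw [h.edge_snd hi.le]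
  obtain ⟨m, hm⟩ : ∃ m, K - i = m + 1 := ⟨K - i - 1, by omega⟩
  rw [hm]
  linarith [(edge_fst_mono h.pos h.lt m).2]

theorem IsSpecialParameter.edgeForm_mono {θ : ℝ} {K : ℕ} (h : IsSpecialParameter K θ) {i : ℕ}
    (hi : i ≤ K) {p q : ℝ × ℝ} (hpq : p ≤ q) : edgeForm θ i p ≤ edgeForm θ i q := by
  have ht := tc_pos h.pos h.lt
  have hs := sc_lt_half h.pos h.lt
  have hb : 0 < 1 - 2 * sc θ := by linarith
  apply div_le_div_of_nonneg_right _ (by positivity)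
  have := mul_le_mul_of_nonneg_left hpq.2 (edge_fst_mono h.pos h.lt i).1
  have := mul_le_mul_of_nonneg_left hpq.1 (neg_nonneg.2 (h.edge_snd_nonpos hi))
  linarith

theorem IsSpecialParameter.one_lt_edgeForm_Z {θ : ℝ} {K : ℕ} (h : IsSpecialParameter K θ) {i : ℕ}
    (hi : i < K) : 1 < edgeForm θ i Z := by
  have ht := tc_pos h.pos h.lt
  have hs := sc_lt_half h.pos h.lt
  have hts := tc_lt_sc h.pos h.lt
  have hb : 0 < 1 - 2 * sc θ := by linarith
  refine (one_le_edgeForm_vert h.pos h.lt i K).trans_lt ?_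
  rw [h.vert_eq]
  apply div_lt_div_of_pos_right _ (by positivity)
  have h1 := mul_nonneg (edge_fst_mono h.pos h.lt i).1 (by linarith : 0 ≤ 1 / 2 - tc θ)
  have h2 := mul_pos (neg_pos.2 (h.edge_snd_neg hi)) (by linarith : 0 < 1 / 2 - sc θ)
  simp only [Z]
  linarith

/-- The vertices `vert θ k`, `k ≤ K`, lie in the rectangle with opposite corners `P 3`, `P 0`. -/
theorem IsSpecialParameter.vert_bounds {θ : ℝ} {K : ℕ} (h : IsSpecialParameter K θ) {k : ℕ}
    (hk : k ≤ K) : tc θ ≤ (vert θ k).1 ∧ (vert θ k).1 ≤ sc θ ∧ tc θ ≤ (vert θ k).2 ∧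
      (vert θ k).2 ≤ 1 - sc θ := by
  have up : ∀ k ≤ K, tc θ ≤ (vert θ k).1 ∧ (vert θ k).2 ≤ 1 - sc θ := by
    intro k hk
    induction k with
    | zero => rw [vert_zero]; exact ⟨le_rfl, le_rfl⟩
    | succ k ih =>
      have := ih (by omega)
      rw [vert_succ_eq, Prod.fst_add, Prod.snd_add]
      have := (edge_fst_mono h.pos h.lt k).1
      have := h.edge_snd_nonpos (i := k) (by omega)
      constructor <;> linarith
  have down : ∀ j ≤ K, (vert θ (K - j)).1 ≤ sc θ ∧ tc θ ≤ (vert θ (K - j)).2 := by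
    intro j hj
    induction j with
    | zero => rw [Nat.sub_zero, h.vert_eq]; exact ⟨le_rfl, le_rfl⟩
    | succ j ih =>
      have ih := ih (by omega)
      obtain ⟨m, hm⟩ : ∃ m, K - j = m + 1 := ⟨K - j - 1, by omega⟩
      rw [show K - (j + 1) = m by omega]
      rw [hm, vert_succ_eq, Prod.fst_add, Prod.snd_add] at ih
      have := (edge_fst_mono h.pos h.lt m).1
      have := h.edge_snd_nonpos (i := m) (by omega)
      constructor <;> linarith
  have := up k hk
  have := down (K - k) (Nat.sub_le _ _)
  rw [Nat.sub_sub_self hk] at this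
  tauto

/-! ### A quarter of a leaf -/

/-- The first `n` edges of the leaf at height `l`, run through in time `l` each: the displacement
from the starting point at time `w`. Written with truncations rather than cases, so that
it is jointly continuous in `l` and `w`. -/
def arcSum (θ : ℝ) (n : ℕ) (l w : ℝ) : ℝ × ℝ :=
  ∑ i ∈ Finset.range n, max 0 (min (w - i * l) l) • edge θ i

/-- A parametrization of a quarter of the leaf at height `l`. It runs through the polygon with the
vertices `l • vert θ i`, `i ≤ K`, in the triangle `B 0`, and then along a horizontal line
through `A 0`. The speed is such that `F` acts as the translation by `l`. -/
def arc (θ : ℝ) (K : ℕ) (l w : ℝ) : ℝ × ℝ :=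
  l • vert θ 0 + arcSum θ K l w + max (w - K * l) 0 • edge θ K

/-- The time in which `arc θ K l` runs through a quarter of the leaf at height `l`. -/
def quarter (θ : ℝ) (K : ℕ) (l : ℝ) : ℝ := K * l + (1 - l) / (1 - 2 * sc θ)

theorem continuous_arc (θ : ℝ) (K : ℕ) : Continuous fun x : ℝ × ℝ => arc θ K x.1 x.2 := by
  unfold arc arcSum
  fun_prop

theorem arcSum_of_le {θ l : ℝ} (hl : 0 ≤ l) (n : ℕ) {w : ℝ} (hw : n * l ≤ w) :
    arcSum θ n l w = l • (vert θ n - vert θ 0) := by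
  induction n with
  | zero => simp [arcSum]
  | succ n ih =>
    push_cast at hw
    have e : max 0 (min (w - n * l) l) = l := by
      rw [min_eq_right (by linarith), max_eq_right hl]
    rw [arcSum, Finset.sum_range_succ, ← arcSum, ih (by linarith), e, edge]
    module

theorem arcSum_of_ge {θ l : ℝ} (hl : 0 ≤ l) {m n : ℕ} (hmn : m ≤ n) {w : ℝ} (hw : w ≤ m * l) :
    arcSum θ n l w = arcSum θ m l w := by
  induction n, hmn using Nat.le_induction with
  | base => rfl
  | succ n hn ih =>
    have hle : (m : ℝ) * l ≤ n * l := mul_le_mul_of_nonneg_right (by exact_mod_cast hn) hl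
    have e : max 0 (min (w - n * l) l) = 0 := by
      rw [min_eq_left (by linarith), max_eq_left (by linarith)]
    rw [arcSum, Finset.sum_range_succ, ← arcSum, ih, e, zero_smul, add_zero]

theorem arc_edge {θ l : ℝ} (hl : 0 ≤ l) {j K : ℕ} (hj : j < K) {f : ℝ} (hf0 : 0 ≤ f)
    (hf1 : f ≤ 1) : arc θ K l (l * (j + f)) = l • (vert θ j + f • edge θ j) := by
  have hlf0 := mul_nonneg hl hf0
  have hlf1 := mul_le_of_le_one_right hl hf1
  have hle : ((j + 1 : ℕ) : ℝ) * l ≤ K * l := mul_le_mul_of_nonneg_right (by exact_mod_cast hj) hl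
  have hj' : l * (j + f) ≤ (j + 1 : ℕ) * l := by push_cast; linarith
  have e1 : max (l * (j + f) - K * l) 0 = 0 := max_eq_right (by linarith)
  have e2 : max 0 (min (l * (j + f) - j * l) l) = l * f := by
    rw [show l * (j + f) - j * l = l * f by ring, min_eq_left hlf1, max_eq_right hlf0]
  rw [arc, e1, arcSum_of_ge hl hj hj', arcSum, Finset.sum_range_succ, ← arcSum,
    arcSum_of_le hl j (by linarith), e2]
  module

theorem arc_straight {θ l : ℝ} (hl : 0 ≤ l) {K : ℕ} {g : ℝ} (hg : 0 ≤ g) :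
    arc θ K l (K * l + g) = l • vert θ K + g • edge θ K := by
  rw [arc, arcSum_of_le hl K (by linarith), add_sub_cancel_left, max_eq_left hg]
  module

/-- Every time is that of a point on an edge or on the straight end of the arc. -/
theorem arc_time_cases {l : ℝ} (hl : 0 ≤ l) (K : ℕ) {w : ℝ} (hw : 0 ≤ w) :
    (∃ j < K, ∃ f : ℝ, 0 ≤ f ∧ f < 1 ∧ w = l * (j + f)) ∨ ∃ g : ℝ, 0 ≤ g ∧ w = K * l + g := by
  rcases lt_or_ge w (K * l) with h | h
  · left
    have hl' : 0 < l := by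
      rcases hl.eq_or_lt with rfl | hl'
      · simp at h; linarith
      · exact hl'
    have hwl : 0 ≤ w / l := by positivity
    refine ⟨⌊w / l⌋₊, (Nat.floor_lt hwl).2 ((div_lt_iff₀ hl').2 h), w / l - ⌊w / l⌋₊, ?_, ?_, ?_⟩
    · linarith [Nat.floor_le hwl]
    · linarith [Nat.lt_floor_add_one (w / l)]
    · field_simp
      ring
  · exact .inr ⟨w - K * l, by linarith, by ring⟩

section special

variable {θ : ℝ} {K : ℕ} (h : IsSpecialParameter K θ)
include h

theorem IsSpecialParameter.width_pos : 0 < 1 - 2 * sc θ := by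
  linarith [sc_lt_half h.pos h.lt]

theorem IsSpecialParameter.lt_quarter (hK : 3 ≤ K) {l : ℝ} (hl0 : 0 ≤ l) (hl1 : l ≤ 1) :
    l < quarter θ K l := by
  have hb := h.width_pos
  have hK' : (3 : ℝ) ≤ K := by exact_mod_cast hK
  unfold quarter
  rcases hl0.eq_or_lt with rfl | hl
  · simpa using hb
  · nlinarith [div_nonneg (sub_nonneg.2 hl1) hb.le]

theorem IsSpecialParameter.quarter_pos (hK : 3 ≤ K) {l : ℝ} (hl0 : 0 ≤ l) (hl1 : l ≤ 1) :
    0 < quarter θ K l := hl0.trans_lt (h.lt_quarter hK hl0 hl1)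

/-- Positions on the leaf: on an edge in `B 0`, or on the horizontal segment in `A 0`. -/
theorem IsSpecialParameter.arc_cases {l : ℝ} (hl0 : 0 ≤ l) {w : ℝ} (hw0 : 0 ≤ w)
    (hw1 : w ≤ quarter θ K l) :
    (∃ j < K, ∃ f : ℝ, 0 ≤ f ∧ f < 1 ∧ w = l * (j + f) ∧
      arc θ K l w = l • (vert θ j + f • edge θ j)) ∨
    ∃ g : ℝ, 0 ≤ g ∧ g * (1 - 2 * sc θ) ≤ 1 - l ∧ w = K * l + g ∧
      arc θ K l w = (l * sc θ + g * (1 - 2 * sc θ), l * tc θ) := by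
  rcases arc_time_cases hl0 K hw0 with ⟨j, hj, f, hf0, hf1, rfl⟩ | ⟨g, hg, rfl⟩
  · exact .inl ⟨j, hj, f, hf0, hf1, rfl, arc_edge hl0 hj hf0 hf1.le⟩
  · refine .inr ⟨g, hg, ?_, rfl, ?_⟩
    · rw [quarter, add_le_add_iff_left, le_div_iff₀ h.width_pos] at hw1
      exact hw1
    · rw [arc_straight hl0 hg, h.vert_eq, h.edge_eq]
      ext <;> simp

theorem IsSpecialParameter.edge_point_mem {j : ℕ} (hj : j < K) {l f : ℝ} (hl0 : 0 ≤ l)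
    (hl1 : l ≤ 1) (hf0 : 0 ≤ f) (hf1 : f ≤ 1) :
    l • (vert θ j + f • edge θ j) ∈ pieceB θ 0 := by
  have hc : Convex ℝ (pieceB θ 0) := convex_convexHull ℝ _
  have h0 : (0 : ℝ × ℝ) ∈ pieceB θ 0 := subset_convexHull ℝ _ (.inl rfl)
  have h2 : vert θ j + f • edge θ j ∈ pieceB θ 0 :=
    hc.add_smul_sub_mem (h.vert_mem hj.le) (h.vert_mem hj) ⟨hf0, hf1⟩
  have := hc.add_smul_sub_mem h0 h2 ⟨hl0, hl1⟩
  simpa using this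

theorem IsSpecialParameter.straight_point_mem {l g : ℝ} (hl0 : 0 ≤ l) (hg : 0 ≤ g)
    (hgl : g * (1 - 2 * sc θ) ≤ 1 - l) :
    (l * sc θ + g * (1 - 2 * sc θ), l * tc θ) ∈ pieceA θ 0 :=
  mem_pieceA_zero.2 ⟨g * (1 - 2 * sc θ), l, mul_nonneg hg h.width_pos.le, hl0, by linarith,
    by rw [add_comm]⟩

theorem IsSpecialParameter.arc_mem {l : ℝ} (hl0 : 0 ≤ l) (hl1 : l ≤ 1) {w : ℝ} (hw0 : 0 ≤ w)
    (hw1 : w ≤ quarter θ K l) : arc θ K l w ∈ pieceA θ 0 ∪ pieceB θ 0 := by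
  rcases h.arc_cases hl0 hw0 hw1 with ⟨j, hj, f, hf0, hf1, -, e⟩ | ⟨g, hg, hgl, -, e⟩
  · exact .inr (e ▸ h.edge_point_mem hj hl0 hl1 hf0 hf1.le)
  · exact .inl (e ▸ h.straight_point_mem hl0 hg hgl)

/-- Along a quarter of a leaf, `F` is a translation of the time. -/
theorem IsSpecialParameter.F_arc {l : ℝ} (hl0 : 0 ≤ l) (hl1 : l ≤ 1) {w : ℝ} (hw0 : 0 ≤ w)
    (hw1 : w ≤ quarter θ K l) : F θ (arc θ K l w) = arc θ K l (w + l) := by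
  rcases h.arc_cases hl0 hw0 hw1 with ⟨j, hj, f, hf0, hf1, hw, e⟩ | ⟨g, hg, hgl, hw, e⟩
  · rw [e, F_of_mem_B h.pos h.lt (h.edge_point_mem hj hl0 hl1 hf0 hf1.le), mapB_smul, mapB_add,
      mapB_smul, ← vert_succ, ← edge_succ, hw]
    rcases (show j + 1 ≤ K from hj).eq_or_lt with hj' | hj'
    · have : l * (j + f) + l = K * l + l * f := by rw [← hj']; push_cast; ring
      rw [this, arc_straight hl0 (mul_nonneg hl0 hf0), hj', smul_add, smul_smul]
    · have : l * (j + f) + l = l * ((j + 1 : ℕ) + f) := by push_cast; ring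
      rw [this, arc_edge hl0 hj' hf0 hf1.le]
  · rw [e, F_of_mem_A h.pos h.lt (h.straight_point_mem hl0 hg hgl), mapA_coord h.pos h.lt, hw,
      add_assoc (K * l), arc_straight hl0 (by linarith), h.vert_eq, h.edge_eq]
    ext <;> simp
    ring

theorem IsSpecialParameter.arc_start (hK : 3 ≤ K) {l : ℝ} (hl0 : 0 ≤ l) {w : ℝ} (hw0 : 0 ≤ w)
    (hw1 : w ≤ l) :
    arc θ K l w = (l * tc θ, l * (1 - sc θ) - w * (1 - 2 * sc θ)) := by
  rcases hl0.eq_or_lt with rfl | hl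
  · obtain rfl : w = 0 := le_antisymm hw1 hw0
    have := arc_edge (θ := θ) (K := K) (j := 0) (l := 0) le_rfl (by omega) (f := 0) le_rfl
      zero_le_one
    rw [zero_mul, zero_smul] at this
    rw [this]
    ext <;> simp
  · have e := arc_edge (θ := θ) (K := K) hl0 (j := 0) (by omega) (f := w / l) (by positivity)
      ((div_le_one hl).2 hw1)
    have : l * ((0 : ℕ) + w / l) = w := by field_simp; simp
    rw [this] at e
    rw [e, vert_zero, edge_zero h.pos h.lt]
    ext <;> simp
    field_simp
    ring

theorem IsSpecialParameter.arc_zero (hK : 3 ≤ K) {l : ℝ} (hl0 : 0 ≤ l) :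
    arc θ K l 0 = (l * tc θ, l * (1 - sc θ)) := by
  rw [h.arc_start hK hl0 le_rfl hl0]
  simp

/-- The end of a quarter of a leaf continues into the rotated quarter. -/
theorem IsSpecialParameter.arc_quarter_add (hK : 3 ≤ K) {l : ℝ} (hl0 : 0 ≤ l) (hl1 : l ≤ 1)
    {w : ℝ} (hw0 : 0 ≤ w) (hw1 : w ≤ l) :
    arc θ K l (quarter θ K l + w) = rot (arc θ K l w) := by
  have hb := h.width_pos
  rw [h.arc_start hK hl0 hw0 hw1, quarter, add_assoc,
    arc_straight hl0 (add_nonneg (div_nonneg (by linarith) hb.le) hw0), h.vert_eq, h.edge_eq]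
  have e := div_mul_cancel₀ (1 - l) hb.ne'
  ext <;> simp [rot]
  linear_combination e

/-- A quarter of a leaf lies in the box spanned by its end points. -/
theorem IsSpecialParameter.arc_bounds {l : ℝ} (hl0 : 0 ≤ l) (hl1 : l ≤ 1) {w : ℝ} (hw0 : 0 ≤ w)
    (hw1 : w ≤ quarter θ K l) :
    l * tc θ ≤ (arc θ K l w).1 ∧ (arc θ K l w).1 ≤ 1 - l * (1 - sc θ) ∧
    l * tc θ ≤ (arc θ K l w).2 ∧ (arc θ K l w).2 ≤ l * (1 - sc θ) := by
  have ht := tc_pos h.pos h.lt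
  have hts := tc_lt_sc h.pos h.lt
  have hs := sc_lt_half h.pos h.lt
  rcases h.arc_cases hl0 hw0 hw1 with ⟨j, hj, f, hf0, hf1, -, e⟩ | ⟨g, hg, hgl, -, e⟩
  · rw [e]
    obtain ⟨u1, u2, u3, u4⟩ := h.vert_bounds hj.le
    obtain ⟨v1, v2, v3, v4⟩ := h.vert_bounds (show j + 1 ≤ K from hj)
    have e' : vert θ j + f • edge θ j = (1 - f) • vert θ j + f • vert θ (j + 1) := by
      rw [edge]; module
    have hf : 0 ≤ 1 - f := by linarith
    rw [e']
    simp only [Prod.smul_fst, Prod.smul_snd, Prod.fst_add, Prod.snd_add, smul_eq_mul]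
    have c1 : tc θ ≤ (1 - f) * (vert θ j).1 + f * (vert θ (j + 1)).1 := by nlinarith
    have c2 : (1 - f) * (vert θ j).1 + f * (vert θ (j + 1)).1 ≤ sc θ := by nlinarith
    have c3 : tc θ ≤ (1 - f) * (vert θ j).2 + f * (vert θ (j + 1)).2 := by nlinarith
    have c4 : (1 - f) * (vert θ j).2 + f * (vert θ (j + 1)).2 ≤ 1 - sc θ := by nlinarith
    refine ⟨mul_le_mul_of_nonneg_left c1 hl0, ?_, mul_le_mul_of_nonneg_left c3 hl0,
      mul_le_mul_of_nonneg_left c4 hl0⟩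
    nlinarith [mul_le_mul_of_nonneg_left c2 hl0]
  · rw [e]
    have := mul_nonneg hg h.width_pos.le
    refine ⟨?_, ?_, le_rfl, ?_⟩ <;> dsimp only <;> nlinarith

end special

/-! ### The height function -/

/-- The height of a point: the least of the linear forms `edgeForm θ i` at the four rotates of the
point. It is a concave function whose level sets are the leaves. -/
def height (θ : ℝ) (K : ℕ) (p : ℝ × ℝ) : ℝ :=
  ⨅ x : Fin K × Fin 4, edgeForm θ x.1 (rot^[x.2] p)

theorem le_height_iff {θ : ℝ} {K : ℕ} (hK : 3 ≤ K) {p : ℝ × ℝ} {c : ℝ} :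
    c ≤ height θ K p ↔ ∀ i < K, ∀ j, c ≤ edgeForm θ i (rot^[j] p) := by
  have : Nonempty (Fin K × Fin 4) := ⟨⟨0, by omega⟩, 0⟩
  rw [height, le_ciInf_iff (finite_range _).bddBelow]
  constructor
  · intro h i hi j
    rw [← rot_iterate_mod]
    exact h (⟨i, hi⟩, ⟨j % 4, Nat.mod_lt _ (by norm_num)⟩)
  · intro h x
    exact h _ x.1.2 _

theorem height_le {θ : ℝ} {K : ℕ} (hK : 3 ≤ K) (p : ℝ × ℝ) {i : ℕ} (hi : i < K) (j : ℕ) :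
    height θ K p ≤ edgeForm θ i (rot^[j] p) := (le_height_iff hK).1 le_rfl i hi j

theorem exists_height_eq {θ : ℝ} {K : ℕ} (hK : 3 ≤ K) (p : ℝ × ℝ) :
    ∃ i < K, ∃ j, height θ K p = edgeForm θ i (rot^[j] p) := by
  have : Nonempty (Fin K × Fin 4) := ⟨⟨0, by omega⟩, 0⟩
  obtain ⟨x, hx⟩ := exists_eq_ciInf_of_finite (f := fun x : Fin K × Fin 4 =>
    edgeForm θ x.1 (rot^[x.2] p))
  exact ⟨x.1, x.1.2, x.2, hx.symm⟩

theorem continuous_height (θ : ℝ) (K : ℕ) (hK : 3 ≤ K) : Continuous (height θ K) := by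
  have hne : Nonempty (Fin K × Fin 4) := ⟨⟨0, by omega⟩, 0⟩
  have e : height θ K = fun p => (Finset.univ : Finset (Fin K × Fin 4)).inf' Finset.univ_nonempty
      fun x => edgeForm θ x.1 (rot^[x.2] p) := by
    ext p
    rw [height, Finset.inf'_univ_eq_ciInf]
  rw [e]
  refine Continuous.finset_inf'_apply _ fun x _ => ?_
  have := continuous_rot.iterate x.2
  unfold edgeForm
  fun_prop

theorem height_le_height_rot {θ : ℝ} {K : ℕ} (hK : 3 ≤ K) (p : ℝ × ℝ) :
    height θ K p ≤ height θ K (rot p) :=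
  (le_height_iff hK).2 fun i hi j => by
    rw [← Function.iterate_succ_apply]
    exact height_le hK p hi _

theorem height_rot {θ : ℝ} {K : ℕ} (hK : 3 ≤ K) (p : ℝ × ℝ) :
    height θ K (rot p) = height θ K p := by
  refine le_antisymm ?_ (height_le_height_rot hK p)
  have h4 : rot (rot (rot (rot p))) = p := rot_four p
  calc height θ K (rot p) ≤ height θ K (rot (rot (rot (rot p)))) :=
        ((height_le_height_rot hK _).trans (height_le_height_rot hK _)).trans
          (height_le_height_rot hK _)
    _ = height θ K p := by rw [h4]

theorem height_rot_iterate {θ : ℝ} {K : ℕ} (hK : 3 ≤ K) (j : ℕ) (p : ℝ × ℝ) :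
    height θ K (rot^[j] p) = height θ K p := by
  induction j with
  | zero => rfl
  | succ j ih => rw [Function.iterate_succ_apply', height_rot hK, ih]

theorem rot_iterate_Z (j : ℕ) : rot^[j] Z = Z := by
  induction j with
  | zero => rfl
  | succ j ih => rw [Function.iterate_succ_apply', ih]; ext <;> norm_num [rot, Z]

theorem rot_comb (c : ℝ) (p : ℝ × ℝ) (j : ℕ) :
    rot^[j] (Z + c • (p - Z)) = Z + c • (rot^[j] p - Z) := by
  induction j with
  | zero => rfl
  | succ j ih =>
    rw [Function.iterate_succ_apply', ih, Function.iterate_succ_apply']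
    ext <;> simp [rot, Z]
    ring

/-- The linear forms along a ray from the centre. -/
theorem edgeForm_ray (θ : ℝ) (i j : ℕ) (c : ℝ) (p : ℝ × ℝ) :
    edgeForm θ i (rot^[j] (Z + c • (p - Z))) =
      (1 - c) * edgeForm θ i Z + c * edgeForm θ i (rot^[j] p) := by
  rw [rot_comb, edgeForm_add, edgeForm_smul, edgeForm_sub]
  ring

section special

variable {θ : ℝ} {K : ℕ} (h : IsSpecialParameter K θ)
include h

theorem IsSpecialParameter.one_lt_height_Z (hK : 3 ≤ K) : 1 < height θ K Z := by
  obtain ⟨i, hi, j, e⟩ := exists_height_eq (θ := θ) hK Z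
  rw [e, rot_iterate_Z]
  exact h.one_lt_edgeForm_Z hi

/-- A ray from the centre meets each level set of the height, up to height `1`, at most once. -/
theorem IsSpecialParameter.ray_unique (hK : 3 ≤ K) {p : ℝ × ℝ} {c : ℝ} (hc : 0 < c)
    (hp : height θ K p ≤ 1) (he : height θ K (Z + c • (p - Z)) = height θ K p) : c = 1 := by
  -- moving away from the centre strictly decreases the form that realizes the height
  have key : ∀ (q : ℝ × ℝ) (d : ℝ), 1 < d → height θ K q ≤ 1 →
      height θ K (Z + d • (q - Z)) < height θ K q := by
    intro q d hd hq
    obtain ⟨i, hi, j, e⟩ := exists_height_eq (θ := θ) hK q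
    refine (height_le hK _ hi j).trans_lt ?_
    rw [edgeForm_ray, ← e]
    nlinarith [h.one_lt_edgeForm_Z hi]
  rcases lt_trichotomy c 1 with hlt | heq | hgt
  · exfalso
    have := key (Z + c • (p - Z)) c⁻¹ ((one_lt_inv₀ hc).2 hlt) (he.trans_le hp)
    have e : Z + c⁻¹ • (Z + c • (p - Z) - Z) = p := by
      rw [add_sub_cancel_left, smul_smul, inv_mul_cancel₀ hc.ne', one_smul, add_sub_cancel]
    rw [e, he] at this
    exact lt_irrefl _ this
  · exact heq
  · exact absurd he (key p c hgt hp).ne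

theorem IsSpecialParameter.le_edgeForm_arc {l : ℝ} (hl0 : 0 ≤ l) {w : ℝ}
    (hw0 : 0 ≤ w) (hw1 : w ≤ quarter θ K l) {i : ℕ} (hi : i ≤ K) :
    l ≤ edgeForm θ i (arc θ K l w) := by
  rcases h.arc_cases hl0 hw0 hw1 with ⟨j, hj, f, hf0, hf1, -, e⟩ | ⟨g, hg, hgl, -, e⟩
  · have e' : vert θ j + f • edge θ j = (1 - f) • vert θ j + f • vert θ (j + 1) := by
      rw [edge]; module
    rw [e, e', edgeForm_smul, edgeForm_add, edgeForm_smul, edgeForm_smul]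
    have e1 := one_le_edgeForm_vert h.pos h.lt i j
    have e2 := one_le_edgeForm_vert h.pos h.lt i (j + 1)
    have : 1 ≤ (1 - f) * edgeForm θ i (vert θ j) + f * edgeForm θ i (vert θ (j + 1)) := by
      nlinarith
    nlinarith
  · have hle : l • vert θ K ≤ (l * sc θ + g * (1 - 2 * sc θ), l * tc θ) := by
      rw [h.vert_eq]
      refine ⟨?_, le_rfl⟩
      have := mul_nonneg hg h.width_pos.le
      simpa using this
    rw [e]
    refine le_trans ?_ (h.edgeForm_mono hi hle)
    rw [edgeForm_smul]
    exact le_mul_of_one_le_right hl0 (one_le_edgeForm_vert h.pos h.lt i K)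

/-- Every point of the leaf has the same height. -/
theorem IsSpecialParameter.height_arc (hK : 3 ≤ K) {l : ℝ} (hl0 : 0 ≤ l) (hl1 : l ≤ 1) {w : ℝ}
    (hw0 : 0 ≤ w) (hw1 : w ≤ quarter θ K l) : height θ K (arc θ K l w) = l := by
  have ht := tc_pos h.pos h.lt
  have hts := tc_lt_sc h.pos h.lt
  have hs := sc_lt_half h.pos h.lt
  obtain ⟨b1, b2, b3, b4⟩ := h.arc_bounds hl0 hl1 hw0 hw1
  apply le_antisymm
  · rcases h.arc_cases hl0 hw0 hw1 with ⟨j, hj, f, hf0, hf1, -, e⟩ | ⟨g, hg, hgl, -, e⟩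
    · refine (height_le hK _ hj 0).trans ?_
      rw [Function.iterate_zero, id, e, edgeForm_smul, edgeForm_add, edgeForm_smul, edgeForm_edge,
        edgeForm_vert_self h.pos h.lt]
      simp
    · refine (height_le hK _ (show 0 < K by omega) 3).trans ?_
      rw [edgeForm_zero h.pos h.lt, e]
      simp [rot, ht.ne']
  · rw [le_height_iff hK]
    intro i hi j
    -- a rotate of the arc lies above and to the right of one of its end points
    have up : ∀ k q, l • vert θ k ≤ q → l ≤ edgeForm θ i q := by
      intro k q hq
      refine le_trans ?_ (h.edgeForm_mono hi.le hq)
      rw [edgeForm_smul]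
      exact le_mul_of_one_le_right hl0 (one_le_edgeForm_vert h.pos h.lt i k)
    rw [← rot_iterate_mod]
    have hj4 : j % 4 < 4 := Nat.mod_lt _ (by norm_num)
    generalize j % 4 = k at hj4
    set p := arc θ K l w with hp
    interval_cases k
    · exact h.le_edgeForm_arc hl0 hw0 hw1 hi.le
    · apply up K
      rw [h.vert_eq]
      constructor
      · simp [rot]; nlinarith
      · simpa [rot] using b1
    · apply up K
      rw [h.vert_eq]
      constructor
      · simp [rot]; nlinarith
      · simp [rot]; nlinarith
    · apply up 0
      rw [vert_zero]
      constructor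
      · simpa [rot] using b3
      · simp [rot]; nlinarith

end special

/-! ### The leaves as closed curves -/

/-- The rotation about the centre by the angle `φ`. -/
def rotAngle (φ : ℝ) (p : ℝ × ℝ) : ℝ × ℝ :=
  (1 / 2 + (Real.cos φ * (p.1 - 1 / 2) - Real.sin φ * (p.2 - 1 / 2)),
   1 / 2 + (Real.sin φ * (p.1 - 1 / 2) + Real.cos φ * (p.2 - 1 / 2)))

theorem rotAngle_add (a b : ℝ) (p : ℝ × ℝ) : rotAngle (a + b) p = rotAngle a (rotAngle b p) := by
  ext <;> simp only [rotAngle, Real.cos_add, Real.sin_add] <;> ring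

theorem continuous_rotAngle {X : Type*} [TopologicalSpace X] {f : X → ℝ} {g : X → ℝ × ℝ}
    (hf : Continuous f) (hg : Continuous g) : Continuous fun x => rotAngle (f x) (g x) := by
  unfold rotAngle
  fun_prop

theorem rotAngle_zero (p : ℝ × ℝ) : rotAngle 0 p = p := by
  ext <;> simp [rotAngle]

theorem rotAngle_pi_div_two (p : ℝ × ℝ) : rotAngle (Real.pi / 2) p = rot p := by
  ext <;> simp [rotAngle, rot]
  ring

theorem rotAngle_nat (n : ℕ) (p : ℝ × ℝ) : rotAngle (Real.pi / 2 * n) p = rot^[n] p := by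
  induction n with
  | zero => simp [rotAngle_zero]
  | succ n ih =>
    rw [Function.iterate_succ_apply', ← ih, ← rotAngle_pi_div_two, ← rotAngle_add]
    congr 1
    push_cast
    ring

theorem rotAngle_int (n : ℤ) (p : ℝ × ℝ) :
    rotAngle (Real.pi / 2 * n) p = rot^[(n % 4).toNat] p := by
  have hn : 0 ≤ n % 4 := Int.emod_nonneg _ (by norm_num)
  have e1 : (((n % 4).toNat : ℕ) : ℝ) = ((n % 4 : ℤ) : ℝ) := by
    exact_mod_cast Int.toNat_of_nonneg hn
  have e2 : (n : ℝ) = ((n % 4 : ℤ) : ℝ) + 4 * ((n / 4 : ℤ) : ℝ) := by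
    exact_mod_cast (Int.emod_add_mul_ediv n 4).symm
  have e3 : Real.pi / 2 * n = Real.pi / 2 * (n % 4).toNat + (n / 4 : ℤ) * (2 * Real.pi) := by
    rw [e1, e2]
    ring
  rw [← rotAngle_nat, e3, rotAngle, Real.cos_add_int_mul_two_pi, Real.sin_add_int_mul_two_pi,
    rotAngle]

/-- The parametrization by `ℝ`, with period `1`, of the leaf at height `l`. Each quarter is a rotate
of the curve `arc θ K l`, run through at constant speed. -/
def leaf (θ : ℝ) (K : ℕ) (l x : ℝ) : ℝ × ℝ :=
  rotAngle (Real.pi / 2 * ⌊4 * x⌋) (arc θ K l (quarter θ K l * Int.fract (4 * x)))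

theorem leaf_add_one (θ : ℝ) (K : ℕ) (l x : ℝ) : leaf θ K l (x + 1) = leaf θ K l x := by
  have e : 4 * (x + 1) = 4 * x + (4 : ℤ) := by push_cast; ring
  rw [leaf, leaf, e, Int.fract_add_intCast, Int.floor_add_intCast]
  rw [rotAngle_int, rotAngle_int]
  simp

/-- The complex number that represents the position of `p` relative to the centre, in coordinates
in which the branch cut of the argument points from the centre towards `E 2`. -/
def offset (p : ℝ × ℝ) : ℂ := ⟨1 - p.1 - p.2, p.1 - p.2⟩

theorem continuous_offset : Continuous offset := by
  have : offset = fun p => ((1 - p.1 - p.2 : ℝ) : ℂ) + ((p.1 - p.2 : ℝ) : ℂ) * Complex.I := by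
    ext p
    simp [offset, Complex.mk_eq_add_mul_I]
  rw [this]
  fun_prop

theorem offset_rot (p : ℝ × ℝ) : offset (rot p) = Complex.I * offset p := by
  apply Complex.ext <;> simp [offset, rot]
  ring

theorem polar_offset (p : ℝ × ℝ) :
    p = (1 / 2 + ‖offset p‖ / √2 * Real.cos ((offset p).arg + 5 * Real.pi / 4),
      1 / 2 + ‖offset p‖ / √2 * Real.sin ((offset p).arg + 5 * Real.pi / 4)) := by
  have h1 : ‖offset p‖ * Real.cos (offset p).arg = 1 - p.1 - p.2 := Complex.norm_mul_cos_arg _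
  have h2 : ‖offset p‖ * Real.sin (offset p).arg = p.1 - p.2 := Complex.norm_mul_sin_arg _
  have e : (offset p).arg + 5 * Real.pi / 4 = (offset p).arg + Real.pi / 4 + Real.pi := by ring
  have hs0 : √2 ≠ 0 := by positivity
  rw [e, Real.cos_add_pi, Real.sin_add_pi, Real.cos_add, Real.sin_add, Real.cos_pi_div_four,
    Real.sin_pi_div_four]
  ext
  · dsimp only
    field_simp
    linear_combination h1 - h2
  · dsimp only
    field_simp
    linear_combination h1 + h2

theorem rotAngle_polar (φ r a : ℝ) :
    rotAngle φ (1 / 2 + r * Real.cos a, 1 / 2 + r * Real.sin a) =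
      (1 / 2 + r * Real.cos (φ + a), 1 / 2 + r * Real.sin (φ + a)) := by
  ext <;> simp only [rotAngle, Real.cos_add, Real.sin_add] <;> ring

theorem sum_clamp {l w : ℝ} (hl : 0 ≤ l) (hw : 0 ≤ w) (n : ℕ) :
    ∑ i ∈ Finset.range n, max 0 (min (w - i * l) l) = min w (n * l) := by
  induction n with
  | zero => simp [hw]
  | succ n ih =>
    rw [Finset.sum_range_succ, ih]
    push_cast
    rcases le_total w (n * l) with h | h
    · rw [min_eq_left h, max_eq_left ((min_le_left _ _).trans (by linarith)), min_eq_left]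
      · ring
      · linarith
    · rw [min_eq_right h, max_eq_right (le_min (by linarith) hl)]
      rcases le_total w ((n + 1) * l) with h' | h'
      · rw [min_eq_left h', min_eq_left (by linarith)]
        ring
      · rw [min_eq_right h', min_eq_right (by linarith)]
        ring

section special

variable {θ : ℝ} {K : ℕ} (h : IsSpecialParameter K θ)
include h

/-- Since all edges point to the lower right, a quarter of a leaf has no self-intersections. -/
theorem IsSpecialParameter.arc_injective {l : ℝ} (hl0 : 0 ≤ l) {w w' : ℝ}
    (hw : 0 ≤ w) (hw' : 0 ≤ w') (e : arc θ K l w = arc θ K l w') : w = w' := by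
  wlog hle : w ≤ w' generalizing w w'
  · exact (this hw' hw e.symm (le_of_not_ge hle)).symm
  have hc : ∀ i ≤ K, 0 < (edge θ i).1 - (edge θ i).2 := by
    intro i hi
    rcases hi.eq_or_lt with rfl | hi
    · rw [h.edge_eq]
      simpa using h.width_pos
    · linarith [(edge_fst_mono h.pos h.lt i).1, h.edge_snd_neg hi]
  have hval : ∀ w, (arc θ K l w).1 - (arc θ K l w).2 = l * ((vert θ 0).1 - (vert θ 0).2) +
      ∑ i ∈ Finset.range K, max 0 (min (w - i * l) l) * ((edge θ i).1 - (edge θ i).2) +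
      max (w - K * l) 0 * ((edge θ K).1 - (edge θ K).2) := by
    intro w
    simp only [arc, arcSum, Prod.fst_add, Prod.snd_add, Prod.smul_fst, Prod.smul_snd, smul_eq_mul,
      Prod.fst_sum, Prod.snd_sum, mul_sub, Finset.sum_sub_distrib]
    ring
  have hmono : ∀ i : ℕ, max 0 (min (w - i * l) l) ≤ max 0 (min (w' - i * l) l) := fun i =>
    max_le_max le_rfl (min_le_min (by linarith) le_rfl)
  have hmono' : max (w - K * l) 0 ≤ max (w' - K * l) 0 := max_le_max (by linarith) le_rfl
  have hterm : ∀ i ∈ Finset.range K, 0 ≤ (max 0 (min (w' - i * l) l) - max 0 (min (w - i * l) l)) *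
      ((edge θ i).1 - (edge θ i).2) := fun i hi =>
    mul_nonneg (sub_nonneg.2 (hmono i)) (hc i (Finset.mem_range.1 hi).le).le
  have hlast := mul_nonneg (sub_nonneg.2 hmono') (hc K le_rfl).le
  have hsum : ∑ i ∈ Finset.range K, (max 0 (min (w' - i * l) l) - max 0 (min (w - i * l) l)) *
      ((edge θ i).1 - (edge θ i).2) + (max (w' - K * l) 0 - max (w - K * l) 0) *
      ((edge θ K).1 - (edge θ K).2) = 0 := by
    have e1 := hval w
    rw [e, hval w'] at e1
    simp only [sub_mul, Finset.sum_sub_distrib]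
    simp only [mul_sub, Finset.sum_sub_distrib] at e1 ⊢
    linarith
  have hs0 := Finset.sum_nonneg hterm
  have hzero := (Finset.sum_eq_zero_iff_of_nonneg hterm).1 (by linarith)
  have hi : ∀ i ∈ Finset.range K, max 0 (min (w - i * l) l) = max 0 (min (w' - i * l) l) := by
    intro i hi
    have := (mul_eq_zero.1 (hzero i hi)).resolve_right (hc i (Finset.mem_range.1 hi).le).ne'
    linarith
  have hK' : max (w - K * l) 0 = max (w' - K * l) 0 := by
    have : (max (w' - K * l) 0 - max (w - K * l) 0) * ((edge θ K).1 - (edge θ K).2) = 0 := by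
      linarith
    linarith [(mul_eq_zero.1 this).resolve_right (hc K le_rfl).ne']
  have hT := Finset.sum_congr rfl hi
  rw [sum_clamp hl0 hw, sum_clamp hl0 hw'] at hT
  have split : ∀ w : ℝ, min w (K * l) + max (w - K * l) 0 = w := by
    intro w
    rcases le_total w (K * l) with h | h
    · rw [min_eq_left h, max_eq_right (by linarith), add_zero]
    · rw [min_eq_right h, max_eq_left (by linarith)]; ring
  rw [← split w, ← split w', hT, hK']

theorem IsSpecialParameter.arc_lt {l : ℝ} (hl0 : 0 ≤ l) (hl1 : l ≤ 1) {w : ℝ} (hw0 : 0 ≤ w)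
    (hw1 : w < quarter θ K l) :
    (arc θ K l w).1 < 1 - l * (1 - sc θ) ∧ (arc θ K l w).1 + (arc θ K l w).2 < 1 := by
  have ht := tc_pos h.pos h.lt
  have hts := tc_lt_sc h.pos h.lt
  have hs := sc_lt_half h.pos h.lt
  rcases h.arc_cases hl0 hw0 hw1.le with ⟨j, hj, f, hf0, hf1, -, e⟩ | ⟨g, hg, hgl, hwg, e⟩
  · constructor
    · have hx : (vert θ j).1 + f * (edge θ j).1 < sc θ := by
        rcases j with _ | j
        · rw [vert_zero, edge_zero h.pos h.lt]
          simpa using hts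
        · have h1 := (edge_fst_mono h.pos h.lt j).2
          have h2 := (h.vert_bounds (k := j + 1 + 1) hj).2.1
          rw [vert_succ_eq, Prod.fst_add] at h2
          nlinarith
      rw [e]
      simp only [Prod.smul_fst, Prod.fst_add, smul_eq_mul]
      rcases hl0.eq_or_lt with rfl | hl
      · simp
      · nlinarith [mul_lt_mul_of_pos_left hx hl]
    · obtain ⟨a, b, ha, hb, hab, e'⟩ :=
        mem_pieceB_zero.1 (h.edge_point_mem hj hl0 hl1 hf0 hf1.le)
      rw [e, e']
      dsimp only
      nlinarith
  · have hlt : g * (1 - 2 * sc θ) < 1 - l := by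
      rwa [hwg, quarter, add_lt_add_iff_left, lt_div_iff₀ h.width_pos] at hw1
    rw [e]
    constructor <;> dsimp only <;> nlinarith

/-- Different quarters of a leaf are disjoint, apart from their end points. -/
theorem IsSpecialParameter.arc_rot_injective {l : ℝ} (hl0 : 0 ≤ l) (hl1 : l ≤ 1)
    {w w' : ℝ} (hw0 : 0 ≤ w) (hw1 : w < quarter θ K l) (hw0' : 0 ≤ w') (hw1' : w' < quarter θ K l)
    {k : ℕ} (hk : k < 4) (e : arc θ K l w = rot^[k] (arc θ K l w')) : k = 0 ∧ w = w' := by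
  have b := h.arc_bounds hl0 hl1 hw0 hw1.le
  have b' := h.arc_bounds hl0 hl1 hw0' hw1'.le
  have c := h.arc_lt hl0 hl1 hw0 hw1
  have c' := h.arc_lt hl0 hl1 hw0' hw1'
  have e1 := congrArg Prod.fst e
  have e2 := congrArg Prod.snd e
  interval_cases k
  · exact ⟨rfl, h.arc_injective hl0 hw0 hw0' e⟩
  all_goals
    exfalso
    simp only [Function.iterate_succ, Function.iterate_zero, Function.comp_apply, id, rot] at e1 e2
    linarith [b.1, b.2.1, b.2.2.1, b.2.2.2, b'.1, b'.2.1, b'.2.2.1, b'.2.2.2, c.1, c.2, c'.1, c'.2]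

theorem IsSpecialParameter.fract_mem (hK : 3 ≤ K) {l : ℝ} (hl0 : 0 ≤ l) (hl1 : l ≤ 1) (x : ℝ) :
    0 ≤ quarter θ K l * Int.fract x ∧ quarter θ K l * Int.fract x < quarter θ K l := by
  have hq := h.quarter_pos hK hl0 hl1
  exact ⟨mul_nonneg hq.le (Int.fract_nonneg _), mul_lt_of_lt_one_right hq (Int.fract_lt_one _)⟩

theorem IsSpecialParameter.leaf_injOn (hK : 3 ≤ K) {l : ℝ} (hl0 : 0 ≤ l) (hl1 : l ≤ 1) :
    InjOn (leaf θ K l) (Ico 0 1) := by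
  have hfloor : ∀ x ∈ Ico (0 : ℝ) 1, ∃ n < 4, (⌊4 * x⌋ : ℤ) = (n : ℕ) := by
    rintro x ⟨hx0, hx1⟩
    have h0 : 0 ≤ ⌊4 * x⌋ := Int.floor_nonneg.2 (by linarith)
    have h4 : ⌊4 * x⌋ < 4 := Int.floor_lt.2 (by push_cast; linarith)
    exact ⟨⌊4 * x⌋.toNat, by omega, by omega⟩
  intro x hx y hy e
  obtain ⟨m, hm, em⟩ := hfloor x hx
  obtain ⟨n, hn, en⟩ := hfloor y hy
  obtain ⟨a0, a1⟩ := h.fract_mem hK hl0 hl1 (4 * x)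
  obtain ⟨b0, b1⟩ := h.fract_mem hK hl0 hl1 (4 * y)
  rw [leaf, leaf, em, en, Int.cast_natCast, Int.cast_natCast, rotAngle_nat, rotAngle_nat] at e
  have e' : arc θ K l (quarter θ K l * Int.fract (4 * x)) =
      rot^[(4 - m + n) % 4] (arc θ K l (quarter θ K l * Int.fract (4 * y))) := by
    rw [rot_iterate_mod, Function.iterate_add_apply, ← e, ← Function.iterate_add_apply,
      Nat.sub_add_cancel hm.le, rot_four]
  obtain ⟨hk, hw⟩ := h.arc_rot_injective hl0 hl1 a0 a1 b0 b1 (Nat.mod_lt _ (by norm_num)) e'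
  have hmn : m = n := by omega
  have hf := mul_left_cancel₀ (h.quarter_pos hK hl0 hl1).ne' hw
  have hx' := Int.floor_add_fract (4 * x)
  have hy' := Int.floor_add_fract (4 * y)
  rw [em, hmn, ← en, hf, hy'] at hx'
  linarith

/-- The curve in terms of the arc that it follows. The formula also holds for times slightly beyond
the end of a quarter, where `arc` runs on a straight line into the next one; images under `F` need
this. -/
theorem IsSpecialParameter.leaf_eq (hK : 3 ≤ K) {l : ℝ} (hl0 : 0 ≤ l) (hl1 : l ≤ 1) {x : ℝ}
    {n : ℤ} {w : ℝ} (hw0 : 0 ≤ w) (hw1 : w ≤ quarter θ K l + l)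
    (hx : 4 * x = n + w / quarter θ K l) :
    leaf θ K l x = rotAngle (Real.pi / 2 * n) (arc θ K l w) := by
  have hq := h.quarter_pos hK hl0 hl1
  have hlt := h.lt_quarter hK hl0 hl1
  rcases lt_or_ge w (quarter θ K l) with hw | hw
  · have hfl : ⌊4 * x⌋ = n := by
      rw [Int.floor_eq_iff, hx]
      have h1 : 0 ≤ w / quarter θ K l := by positivity
      have h2 : w / quarter θ K l < 1 := (div_lt_one hq).2 hw
      constructor <;> linarith
    have hfr : quarter θ K l * Int.fract (4 * x) = w := by
      rw [Int.fract, hfl, hx]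
      field_simp
      ring
    rw [leaf, hfl, hfr]
  · obtain ⟨v, rfl⟩ : ∃ v, w = quarter θ K l + v := ⟨w - quarter θ K l, by ring⟩
    have hv0 : 0 ≤ v := by linarith
    have hv1 : v ≤ l := by linarith
    have hx' : 4 * x = n + 1 + v / quarter θ K l := by rw [hx, add_div, div_self hq.ne']; ring
    have hfl : ⌊4 * x⌋ = n + 1 := by
      rw [Int.floor_eq_iff, hx']
      have h1 : 0 ≤ v / quarter θ K l := by positivity
      have h2 : v / quarter θ K l < 1 := (div_lt_one hq).2 (by linarith)
      push_cast
      constructor <;> linarith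
    have hfr : quarter θ K l * Int.fract (4 * x) = v := by
      rw [Int.fract, hfl, hx']
      push_cast
      field_simp
      ring
    rw [leaf, hfl, hfr, h.arc_quarter_add hK hl0 hl1 hv0 hv1, ← rotAngle_pi_div_two,
      ← rotAngle_add]
    congr 1
    push_cast
    ring

theorem IsSpecialParameter.height_leaf (hK : 3 ≤ K) {l : ℝ} (hl0 : 0 ≤ l) (hl1 : l ≤ 1) (x : ℝ) :
    height θ K (leaf θ K l x) = l := by
  obtain ⟨a0, a1⟩ := h.fract_mem hK hl0 hl1 (4 * x)
  rw [leaf, rotAngle_int, height_rot_iterate hK, h.height_arc hK hl0 hl1 a0 a1.le]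

/-- On each leaf, `F` is conjugate to a rotation. -/
theorem IsSpecialParameter.F_leaf (hK : 3 ≤ K) {l : ℝ} (hl0 : 0 ≤ l) (hl1 : l ≤ 1) (x : ℝ) :
    F θ (leaf θ K l x) = leaf θ K l (l / (4 * quarter θ K l) + x) := by
  have hq := h.quarter_pos hK hl0 hl1
  obtain ⟨a0, a1⟩ := h.fract_mem hK hl0 hl1 (4 * x)
  have e : 4 * (l / (4 * quarter θ K l) + x) =
      ⌊4 * x⌋ + (quarter θ K l * Int.fract (4 * x) + l) / quarter θ K l := by
    have := Int.floor_add_fract (4 * x)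
    field_simp
    linear_combination -quarter θ K l * this
  rw [h.leaf_eq hK hl0 hl1 (by linarith) (by linarith) e, leaf, rotAngle_int, rotAngle_int,
    F_rot_iterate h.pos h.lt _ (h.arc_mem hl0 hl1 a0 a1.le), h.F_arc hl0 hl1 a0 a1.le]

/-- The leaves depend continuously on their height. -/
theorem IsSpecialParameter.continuous_leaf (hK : 3 ≤ K) :
    Continuous fun x : ℝ × unitInterval => leaf θ K x.2 x.1 := by
  -- in a frame that rotates with constant speed, the curve is continuous in the fractional part
  obtain ⟨U, hUdef⟩ : ∃ U : unitInterval → ℝ → ℝ × ℝ, U = fun (l : unitInterval) y =>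
    rotAngle (-(Real.pi / 2 * y)) (arc θ K l (quarter θ K l * y)) := ⟨_, rfl⟩
  have hU : Continuous (Function.uncurry U) := by
    have h1 : Continuous fun x : unitInterval × ℝ =>
        arc θ K x.1 (quarter θ K x.1 * x.2) := by
      have h2 : Continuous fun x : unitInterval × ℝ =>
          (((x.1 : ℝ), quarter θ K x.1 * x.2) : ℝ × ℝ) := by
        unfold quarter
        fun_prop
      exact Continuous.comp (g := fun x : ℝ × ℝ => arc θ K x.1 x.2) (continuous_arc θ K) h2
    have h3 : Continuous fun x : unitInterval × ℝ => -(Real.pi / 2 * x.2) := by fun_prop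
    have h4 : Continuous fun x : unitInterval × ℝ =>
        rotAngle (-(Real.pi / 2 * x.2)) (arc θ K x.1 (quarter θ K x.1 * x.2)) :=
      continuous_rotAngle h3 h1
    refine h4.congr fun x => ?_
    rw [Function.uncurry, hUdef]
  have h01 : ∀ l, U l 0 = U l 1 := by
    intro l
    have e := h.arc_quarter_add hK l.2.1 l.2.2 le_rfl l.2.1
    simp only [hUdef, mul_zero, neg_zero, mul_one]
    rw [add_zero] at e
    rw [e, ← rotAngle_pi_div_two, ← rotAngle_add, neg_add_cancel]
  have hfr : Continuous fun x : ℝ × unitInterval => U x.2 (Int.fract (4 * x.1)) := by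
    have h5 : Continuous fun x : unitInterval × ℝ => U x.1 (Int.fract x.2) :=
      ContinuousOn.comp_fract' (f := U) hU.continuousOn h01
    have h6 : Continuous fun x : ℝ × unitInterval => (x.2, 4 * x.1) := by fun_prop
    exact h5.comp h6
  have h4 : Continuous fun x : ℝ × unitInterval => 2 * Real.pi * x.1 := by fun_prop
  have hcont : Continuous fun x : ℝ × unitInterval =>
      rotAngle (2 * Real.pi * x.1) (U x.2 (Int.fract (4 * x.1))) :=
    continuous_rotAngle h4 hfr
  refine hcont.congr fun x => ?_
  rw [hUdef, leaf, ← rotAngle_add]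
  congr 1
  have := Int.floor_add_fract (4 * x.1)
  linear_combination (-Real.pi / 2) * this

theorem IsSpecialParameter.offset_arc_mem_slitPlane {l : ℝ} (hl0 : 0 ≤ l)
    (hl1 : l ≤ 1) {w : ℝ} (hw0 : 0 ≤ w) (hw1 : w ≤ quarter θ K l) :
    offset (arc θ K l w) ∈ Complex.slitPlane := by
  have ht := tc_pos h.pos h.lt
  have hts := tc_lt_sc h.pos h.lt
  have hs := sc_lt_half h.pos h.lt
  rw [Complex.mem_slitPlane_iff]
  rcases h.arc_cases hl0 hw0 hw1 with ⟨j, hj, f, hf0, hf1, -, e⟩ | ⟨g, hg, hgl, -, e⟩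
  · left
    obtain ⟨a, b, ha, hb, hab, e'⟩ :=
      mem_pieceB_zero.1 (h.edge_point_mem hj hl0 hl1 hf0 hf1.le)
    rw [e, e']
    simp only [offset]
    nlinarith
  · rw [e]
    simp only [offset]
    -- the sum of the real and the imaginary part is positive
    have hsum : 0 < 1 - 2 * (l * tc θ) := by nlinarith
    by_cases hre : 0 < 1 - (l * sc θ + g * (1 - 2 * sc θ)) - l * tc θ
    · exact .inl hre
    · right
      have : 0 < l * sc θ + g * (1 - 2 * sc θ) - l * tc θ := by linarith
      exact this.ne'

/-- The polar angle along a leaf lifts to a continuous function of degree `1`. -/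
theorem IsSpecialParameter.leaf_winding (hK : 3 ≤ K) {l : ℝ} (hl0 : 0 ≤ l) (hl1 : l ≤ 1) :
    ∃ r ψ : ℝ → ℝ, Continuous ψ ∧ (∀ x, 0 < r x) ∧ (∀ x, ψ (x + 1) = ψ x + 1) ∧
    ∀ x, leaf θ K l x = (1 / 2 + r x * Real.cos (2 * Real.pi * ψ x),
      1 / 2 + r x * Real.sin (2 * Real.pi * ψ x)) := by
  have ht := tc_pos h.pos h.lt
  have hts := tc_lt_sc h.pos h.lt
  have hs := sc_lt_half h.pos h.lt
  have hq := h.quarter_pos hK hl0 hl1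
  have hpi := Real.pi_pos
  let z : ℝ → ℂ := fun y => offset (arc θ K l (quarter θ K l * y))
  have hz : Continuous z := by
    have h2 : Continuous fun y : ℝ => ((l, quarter θ K l * y) : ℝ × ℝ) := by fun_prop
    exact continuous_offset.comp ((continuous_arc θ K).comp h2)
  have hslit : ∀ y ∈ Icc (0 : ℝ) 1, z y ∈ Complex.slitPlane := fun y hy =>
    h.offset_arc_mem_slitPlane hl0 hl1 (mul_nonneg hq.le hy.1) (mul_le_of_le_one_right hq.le hy.2)
  -- the deviation of the polar angle from that of a uniform rotation
  let a : ℝ → ℝ := fun y => (z y).arg + 5 * Real.pi / 4 - Real.pi / 2 * y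
  have hacont : ContinuousOn a (Icc 0 1) := by
    have harg : ContinuousOn (fun y => (z y).arg) (Icc 0 1) := fun y hy =>
      ((Complex.continuousAt_arg (hslit y hy)).comp hz.continuousAt).continuousWithinAt
    exact (harg.add continuousOn_const).sub (by fun_prop)
  have ha01 : a 0 = a 1 := by
    have e := h.arc_quarter_add hK hl0 hl1 le_rfl hl0
    rw [add_zero] at e
    have hz0 : z 0 ≠ 0 := Complex.slitPlane_ne_zero (hslit 0 (by simp))
    have hz1 : z 1 = Complex.I * z 0 := by
      simp only [z, mul_one, mul_zero]
      rw [e, offset_rot]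
    have hre : 0 ≤ (z 0).re := by
      simp only [z, mul_zero, offset, h.arc_zero hK hl0]
      nlinarith
    have harg := Complex.arg_le_pi_div_two_iff.2 (.inl hre)
    have e2 : (z 1).arg = Real.pi / 2 + (z 0).arg := by
      rw [hz1, Complex.arg_mul Complex.I_ne_zero hz0, Complex.arg_I]
      rw [Complex.arg_I]
      constructor <;> linarith [Complex.neg_pi_lt_arg (z 0)]
    simp only [a, e2]
    ring
  refine ⟨fun x => ‖z (Int.fract (4 * x))‖ / √2,
    fun x => x + a (Int.fract (4 * x)) / (2 * Real.pi), ?_, ?_, ?_, ?_⟩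
  · have h1 : Continuous fun x => a (Int.fract x) := hacont.comp_fract'' ha01
    have h2 : Continuous fun x : ℝ => a (Int.fract (4 * x)) :=
      h1.comp (continuous_const.mul continuous_id)
    exact continuous_id.add (h2.div_const _)
  · intro x
    have : z (Int.fract (4 * x)) ≠ 0 := Complex.slitPlane_ne_zero
      (hslit _ ⟨Int.fract_nonneg _, (Int.fract_lt_one _).le⟩)
    positivity
  · intro x
    have e : 4 * (x + 1) = 4 * x + (4 : ℤ) := by push_cast; ring
    simp only [e, Int.fract_add_intCast]
    ring
  · intro x
    rw [leaf, polar_offset (arc θ K l _), rotAngle_polar]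
    have e : Real.pi / 2 * ⌊4 * x⌋ + ((z (Int.fract (4 * x))).arg + 5 * Real.pi / 4) =
        2 * Real.pi * (x + a (Int.fract (4 * x)) / (2 * Real.pi)) := by
      have := Int.floor_add_fract (4 * x)
      simp only [a]
      field_simp
      linear_combination (4 * Real.pi) * this
    rw [← e]

theorem IsSpecialParameter.range_leaf (hK : 3 ≤ K) {l : ℝ} (hl0 : 0 ≤ l) (hl1 : l ≤ 1) :
    range (leaf θ K l) = {p | height θ K p = l} := by
  apply Subset.antisymm
  · rintro _ ⟨x, rfl⟩
    exact h.height_leaf hK hl0 hl1 x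
  · intro p hp
    have hp : height θ K p = l := hp
    obtain ⟨r, ψ, hψ, hr, hψ1, hleaf⟩ := h.leaf_winding hK hl0 hl1
    -- the polar angle takes all values, and a ray meets the level set only once
    have hper : Function.Periodic (fun x => ψ x - x) 1 := fun x => by simp only [hψ1]; ring
    have hsurj : ∀ c, ∃ x, ψ x = c := by
      intro c
      have hn : ∀ n : ℤ, ψ n = ψ 0 + n := fun n => by
        have := hper.int_mul_eq n
        simp only [mul_one] at this
        linarith
      refine mem_range_of_exists_le_of_exists_ge hψ ⟨⌊c - ψ 0⌋, ?_⟩ ⟨⌈c - ψ 0⌉, ?_⟩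
      · rw [hn]; linarith [Int.floor_le (c - ψ 0)]
      · rw [hn]; linarith [Int.le_ceil (c - ψ 0)]
    have hpZ : offset p ≠ 0 := by
      intro h0
      have h1 := congrArg Complex.re h0
      have h2 := congrArg Complex.im h0
      simp only [offset, Complex.zero_re, Complex.zero_im] at h1 h2
      have : p = Z := by ext <;> simp only [Z] <;> linarith
      have := h.one_lt_height_Z hK
      rw [← ‹p = Z›, hp] at this
      linarith
    obtain ⟨x, hx⟩ := hsurj (((offset p).arg + 5 * Real.pi / 4) / (2 * Real.pi))
    have hx' : 2 * Real.pi * ψ x = (offset p).arg + 5 * Real.pi / 4 := by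
      rw [hx]
      field_simp
    have hlx := hleaf x
    rw [hx'] at hlx
    have hpos : 0 < ‖offset p‖ / √2 / r x := by
      have := hr x
      positivity
    have hpe : p = Z + (‖offset p‖ / √2 / r x) • (leaf θ K l x - Z) := by
      have hr' := (hr x).ne'
      conv_lhs => rw [polar_offset p]
      rw [hlx]
      ext <;> simp only [Z, Prod.fst_add, Prod.snd_add, Prod.smul_fst, Prod.smul_snd,
        Prod.fst_sub, Prod.snd_sub, smul_eq_mul] <;> field_simp <;> ring
    have hc := h.ray_unique hK (p := leaf θ K l x) hpos
      (by rw [h.height_leaf hK hl0 hl1]; exact hl1)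
      (by rw [← hpe, h.height_leaf hK hl0 hl1, hp])
    rw [hc, one_smul, add_sub_cancel] at hpe
    exact ⟨x, hpe.symm⟩

theorem IsSpecialParameter.isCcwParam_leaf (hK : 3 ≤ K) {l : ℝ} (hl0 : 0 ≤ l) (hl1 : l ≤ 1) :
    IsCcwParam {p | height θ K p = l} (leaf θ K l) where
  cont := by
    have hc : Continuous fun x : ℝ => (x, (⟨l, hl0, hl1⟩ : unitInterval)) := by fun_prop
    exact ((h.continuous_leaf hK).comp hc).congr fun x => rfl
  periodic := leaf_add_one θ K l
  inj := h.leaf_injOn hK hl0 hl1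
  range_eq := h.range_leaf hK hl0 hl1
  winding := h.leaf_winding hK hl0 hl1

theorem IsSpecialParameter.isLiftAlong_leaf (hK : 3 ≤ K) {l : ℝ} (hl0 : 0 ≤ l) (hl1 : l ≤ 1) :
    IsLiftAlong θ (leaf θ K l)
      (CircleDeg1Lift.translate (Multiplicative.ofAdd (l / (4 * quarter θ K l)))) := by
  constructor
  · exact continuous_const.add continuous_id
  · exact h.F_leaf hK hl0 hl1

end special

/-! ### The annulus and its foliation -/

theorem mem_square_iff_coord (p : ℝ × ℝ) :
    p ∈ square ↔ 0 ≤ p.1 ∧ p.1 ≤ 1 ∧ 0 ≤ p.2 ∧ p.2 ≤ 1 := by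
  simp only [square, mem_prod, mem_Icc, and_assoc]

theorem rot_mem_square {p : ℝ × ℝ} (hp : p ∈ square) : rot p ∈ square := by
  rw [mem_square_iff_coord] at hp ⊢
  obtain ⟨h1, h2, h3, h4⟩ := hp
  exact ⟨by simpa [rot] using h4, by simpa [rot] using h3, h1, h2⟩

theorem rot_edge_point (j i : ℕ) (f : ℝ) :
    rot^[j] (vert θ i + f • edge θ i) =
      (1 - f) • rot^[j] (vert θ i) + f • rot^[j] (vert θ (i + 1)) := by
  have e : vert θ i + f • edge θ i = (1 - f) • vert θ i + f • vert θ (i + 1) + (0 : ℝ) • Z := by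
    rw [edge]; module
  rw [e, rot_iterate_comb j (by ring), zero_smul, add_zero]

section special

variable {θ : ℝ} {K : ℕ} (h : IsSpecialParameter K θ)
include h

theorem IsSpecialParameter.mem_square_iff (hK : 3 ≤ K) {p : ℝ × ℝ} :
    p ∈ square ↔ 0 ≤ height θ K p := by
  have ht := tc_pos h.pos h.lt
  constructor
  · intro hp
    rw [le_height_iff hK]
    intro i hi j
    have hj : rot^[j] p ∈ square := by
      induction j with
      | zero => exact hp
      | succ j ih => rw [Function.iterate_succ_apply']; exact rot_mem_square ih
    rw [mem_square_iff_coord] at hj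
    have h0 : (0 : ℝ × ℝ) ≤ rot^[j] p := ⟨hj.1, hj.2.2.1⟩
    have := h.edgeForm_mono hi.le h0
    simpa [edgeForm] using this
  · intro hp
    rw [le_height_iff hK] at hp
    have key : ∀ j, 0 ≤ (rot^[j] p).1 := by
      intro j
      have := hp 0 (by omega) j
      rw [edgeForm_zero h.pos h.lt] at this
      by_contra hneg
      exact absurd this (not_le.2 (div_neg_of_neg_of_pos (not_le.1 hneg) ht))
    have k0 := key 0
    have k1 := key 1
    have k2 := key 2
    have k3 := key 3
    simp only [Function.iterate_succ, Function.iterate_zero, Function.comp_apply, id, rot]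
      at k0 k1 k2 k3
    rw [mem_square_iff_coord]
    refine ⟨?_, ?_, ?_, ?_⟩ <;> linarith

theorem IsSpecialParameter.frontier_square (hK : 3 ≤ K) :
    frontier square = {p | height θ K p = 0} := by
  have ht := tc_pos h.pos h.lt
  have hcl : IsClosed square := isClosed_Icc.prod isClosed_Icc
  have hint : interior square = Ioo 0 1 ×ˢ Ioo 0 1 := by
    rw [square, interior_prod_eq, interior_Icc]
  rw [frontier, hcl.closure_eq, hint]
  ext p
  simp only [Set.mem_sdiff, mem_prod, mem_Ioo, mem_ofPred_eq]
  constructor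
  · rintro ⟨hp, hn⟩
    refine le_antisymm ?_ ((h.mem_square_iff hK).1 hp)
    rw [mem_square_iff_coord] at hp
    obtain ⟨p1, p2, p3, p4⟩ := hp
    have key : ∀ j, (rot^[j] p).1 = 0 → height θ K p ≤ 0 := fun j hj => by
      refine (height_le hK p (show 0 < K by omega) j).trans ?_
      rw [edgeForm_zero h.pos h.lt, hj, zero_div]
    by_contra hpos
    have k0 := mt (key 0) hpos
    have k1 := mt (key 1) hpos
    have k2 := mt (key 2) hpos
    have k3 := mt (key 3) hpos
    simp only [Function.iterate_succ, Function.iterate_zero, Function.comp_apply, id, rot]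
      at k0 k1 k2 k3
    refine hn ⟨⟨p1.lt_of_ne' k0, p2.lt_of_ne fun e => k2 (by linarith)⟩,
      p3.lt_of_ne fun e => k3 (by linarith), p4.lt_of_ne fun e => k1 (by linarith)⟩
  · intro hp
    refine ⟨(h.mem_square_iff hK).2 hp.ge, ?_⟩
    rintro ⟨⟨p1, p2⟩, p3, p4⟩
    obtain ⟨i, hi, j, e⟩ := exists_height_eq (θ := θ) hK p
    have hj : 0 < (rot^[j] p).1 ∧ 0 < (rot^[j] p).2 := by
      rw [← rot_iterate_mod]
      have hj4 : j % 4 < 4 := Nat.mod_lt _ (by norm_num)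
      generalize j % 4 = k at hj4
      interval_cases k <;>
      simp only [Function.iterate_succ, Function.iterate_zero, Function.comp_apply, id, rot] <;>
      constructor <;> linarith
    have hpos : 0 < edgeForm θ i (rot^[j] p) := by
      have hb := h.width_pos
      apply div_pos _ (by positivity)
      have h1 := mul_nonneg (edge_fst_mono h.pos h.lt i).1 hj.2.le
      have h2 := mul_pos (neg_pos.2 (h.edge_snd_neg hi)) hj.1
      linarith
    linarith

theorem IsSpecialParameter.height_edge_point (hK : 3 ≤ K) {i : ℕ} (hi : i < K) {f : ℝ}
    (hf0 : 0 ≤ f) (hf1 : f ≤ 1) : height θ K (vert θ i + f • edge θ i) = 1 := by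
  have e := arc_edge (θ := θ) zero_le_one hi hf0 hf1
  rw [one_mul, one_smul] at e
  rw [← e]
  have : ((i + 1 : ℕ) : ℝ) ≤ K := by exact_mod_cast hi
  push_cast at this
  refine h.height_arc hK zero_le_one le_rfl (by positivity) ?_
  simp only [quarter, sub_self, zero_div, mul_one, add_zero]
  linarith

theorem IsSpecialParameter.vert_K_eq : vert θ K = rot (vert θ 0) := by
  rw [h.vert_eq, vert_zero]
  ext <;> simp [rot]

/-- The orbit of `P 3` passes through the four triangles `B` one after the other. -/
theorem IsSpecialParameter.iterate_P (j : ℕ) {i : ℕ} (hi : i ≤ K) :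
    (F θ)^[i + K * j] (P θ 3) = rot^[j] (vert θ i) := by
  have step : ∀ j, (F θ)^[K * j] (P θ 3) = rot^[j] (vert θ 0) → ∀ i ≤ K,
      (F θ)^[i + K * j] (P θ 3) = rot^[j] (vert θ i) := by
    intro j hj i hi
    induction i with
    | zero => rw [zero_add, hj]
    | succ i ih =>
      have hm : vert θ i ∈ pieceB θ 0 := h.vert_mem (by omega)
      rw [show i + 1 + K * j = (i + K * j) + 1 by ring, Function.iterate_succ_apply',
        ih (by omega), F_rot_iterate h.pos h.lt j (.inr hm), F_of_mem_B h.pos h.lt hm, vert_succ]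
  refine step j ?_ i hi
  induction j with
  | zero => rfl
  | succ j ih =>
    have := step j ih K le_rfl
    rw [Nat.mul_succ, add_comm, this, h.vert_K_eq, ← Function.iterate_succ_apply]

theorem IsSpecialParameter.Gamma0_eq (hK : 3 ≤ K) : Gamma0 θ K = {p | height θ K p = 1} := by
  apply Subset.antisymm
  · intro p hp
    simp only [Gamma0, mem_iUnion, Finset.mem_range, exists_prop] at hp
    obtain ⟨m, hm, hp⟩ := hp
    have hi : m % K < K := Nat.mod_lt _ (by omega)
    have e1 := h.iterate_P (m / K) hi.le
    have e2 := h.iterate_P (m / K) (i := m % K + 1) hi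
    rw [Nat.mod_add_div] at e1
    rw [show m % K + 1 + K * (m / K) = m + 1 by rw [add_right_comm, Nat.mod_add_div]] at e2
    rw [e1, e2] at hp
    obtain ⟨a, b, ha, hb, hab, rfl⟩ := hp
    obtain rfl : a = 1 - b := by linarith
    rw [← rot_edge_point]
    exact (height_rot_iterate hK _ _).trans (h.height_edge_point hK hi hb (by linarith))
  · rw [← h.range_leaf hK zero_le_one le_rfl]
    rintro _ ⟨x, rfl⟩
    obtain ⟨a0, a1⟩ := h.fract_mem hK zero_le_one le_rfl (4 * x)
    have hj4 : (⌊4 * x⌋ % 4).toNat < 4 := by omega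
    rw [leaf, rotAngle_int]
    generalize (⌊4 * x⌋ % 4).toNat = j at hj4
    rcases h.arc_cases zero_le_one a0 a1.le with ⟨i, hi, f, hf0, hf1, -, e⟩ | ⟨g, hg, hgl, hw, -⟩
    · rw [e, one_smul, rot_edge_point]
      simp only [Gamma0, mem_iUnion, Finset.mem_range, exists_prop]
      refine ⟨i + K * j, ?_, ?_⟩
      · have : K * (j + 1) ≤ K * 4 := Nat.mul_le_mul_left K hj4
        rw [Nat.mul_succ] at this
        omega
      · rw [h.iterate_P j hi.le, show i + K * j + 1 = i + 1 + K * j by ring,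
          h.iterate_P j (show i + 1 ≤ K from hi)]
        exact ⟨1 - f, f, by linarith, hf0, by ring, rfl⟩
    · exfalso
      simp only [quarter, sub_self, zero_div, mul_one, add_zero] at a1 hw
      linarith

theorem IsSpecialParameter.P_mem_Gamma0 (hK : 3 ≤ K) (i : ℕ) :
    P θ i ∈ Gamma0 θ K ∧ P' θ i ∈ Gamma0 θ K := by
  have hv : ∀ k < K, height θ K (vert θ k) = 1 := fun k hk => by
    simpa using h.height_edge_point hK hk le_rfl zero_le_one
  rw [h.Gamma0_eq hK]
  constructor
  · have e : P θ i = rot^[i] (rot (vert θ 0)) := by rw [← h.vert_K_eq, h.vert_eq]; rfl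
    change height θ K _ = 1
    rw [e, height_rot_iterate hK, height_rot hK, hv 0 (by omega)]
  · have e : P' θ i = rot^[i] (rot (vert θ 1)) := by
      rw [vert_one h.pos h.lt]
      rfl
    change height θ K _ = 1
    rw [e, height_rot_iterate hK, height_rot hK, hv 1 (by omega)]

theorem IsSpecialParameter.starConvex_height (hK : 3 ≤ K) :
    StarConvex ℝ Z {p | 1 < height θ K p} := by
  intro p hp a b ha hb hab
  have hp : 1 < height θ K p := hp
  have e : a • Z + b • p = Z + b • (p - Z) := by
    rw [show a = 1 - b by linarith]; module
  obtain ⟨i, hi, j, e'⟩ := exists_height_eq (θ := θ) hK (Z + b • (p - Z))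
  change 1 < height θ K _
  rw [e, e', edgeForm_ray]
  have h1 := h.one_lt_edgeForm_Z hi
  have h2 := hp.trans_le (height_le hK p hi j)
  rcases hb.eq_or_lt with rfl | hb
  · simpa using h1
  · nlinarith

theorem IsSpecialParameter.annulus_eq (hK : 3 ≤ K) :
    annulus (Gamma0 θ K) = {p | 0 ≤ height θ K p ∧ height θ K p ≤ 1} := by
  have hcont := continuous_height θ K hK
  have hZ := h.one_lt_height_Z hK
  have hcomp : connectedComponentIn (square \ Gamma0 θ K) Z = {p | 1 < height θ K p} := by
    have hsub : {p | 1 < height θ K p} ⊆ square \ Gamma0 θ K := by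
      intro p hp
      have hp : 1 < height θ K p := hp
      refine ⟨(h.mem_square_iff hK).2 (by linarith), ?_⟩
      rw [h.Gamma0_eq hK]
      exact hp.ne'
    apply Subset.antisymm
    · refine isPreconnected_connectedComponentIn.subset_left_of_subset_union
        (isOpen_lt continuous_const hcont) (isOpen_lt hcont continuous_const)
        (u := {p | 1 < height θ K p}) (v := {p | height θ K p < 1}) ?_ ?_ ?_
      · rw [Set.disjoint_left]
        exact fun p (h1 : 1 < height θ K p) (h2 : height θ K p < 1) => lt_asymm h1 h2
      · intro p hp
        have := (connectedComponentIn_subset _ _ hp).2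
        rw [h.Gamma0_eq hK] at this
        exact (lt_or_gt_of_ne this).symm
      · exact ⟨Z, mem_connectedComponentIn (hsub hZ), hZ⟩
    · have hpre : IsPreconnected {p | 1 < height θ K p} :=
        ((h.starConvex_height hK).isPathConnected hZ).isConnected.isPreconnected
      exact hpre.subset_connectedComponentIn hZ hsub
  ext p
  rw [annulus, hcomp, Set.mem_sdiff, h.mem_square_iff hK]
  simp only [mem_ofPred_eq, not_lt]

theorem IsSpecialParameter.isCircleFoliation (hK : 3 ≤ K) :
    IsCircleFoliation (annulus (Gamma0 θ K)) fun τ => {p | height θ K p = τ} := by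
  have hper : ∀ τ : unitInterval, Function.Periodic (leaf θ K τ) 1 := fun τ => leaf_add_one θ K τ
  let H : UnitAddCircle × unitInterval → ℝ × ℝ := fun x => (hper x.2).lift x.1
  have hH : ∀ (x : ℝ) (τ : unitInterval), H ((x : UnitAddCircle), τ) = leaf θ K τ x :=
    fun x τ => (hper τ).lift_coe x
  have hrep : ∀ q : UnitAddCircle, ∃ x ∈ Ico (0 : ℝ) 1, (x : UnitAddCircle) = q := by
    intro q
    have : q ∈ ((↑) : ℝ → UnitAddCircle) '' Ico 0 (0 + 1) := by
      rw [AddCircle.coe_image_Ico_eq]; trivial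
    simpa using this
  have hheight : ∀ x, height θ K (H x) = x.2 := by
    rintro ⟨q, τ⟩
    obtain ⟨x, -, rfl⟩ := hrep q
    rw [hH]
    exact h.height_leaf hK τ.2.1 τ.2.2 x
  have hlevel : ∀ τ : unitInterval, {p | height θ K p = τ} = H '' (univ ×ˢ {τ}) := by
    intro τ
    rw [← h.range_leaf hK τ.2.1 τ.2.2]
    ext p
    constructor
    · rintro ⟨x, rfl⟩
      exact ⟨(x, τ), by simp, hH x τ⟩
    · rintro ⟨⟨q, σ⟩, ⟨-, hσ⟩, rfl⟩
      obtain rfl : σ = τ := hσ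
      obtain ⟨x, -, rfl⟩ := hrep q
      exact ⟨x, (hH x σ).symm⟩
  refine ⟨H, ?_, ?_, ?_, hlevel⟩
  · have hq : IsQuotientMap
        (Prod.map ((↑) : ℝ → UnitAddCircle) (id : unitInterval → unitInterval)) :=
      (QuotientAddGroup.isOpenQuotientMap_mk.prodMap IsOpenQuotientMap.id).isQuotientMap
    rw [hq.continuous_iff]
    exact (h.continuous_leaf hK).congr fun x => (hH x.1 x.2).symm
  · rintro ⟨q, σ⟩ ⟨q', τ⟩ e
    have hστ : σ = τ := by
      have := congrArg (height θ K) e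
      rw [hheight, hheight] at this
      exact Subtype.ext this
    subst hστ
    obtain ⟨x, hx, rfl⟩ := hrep q
    obtain ⟨y, hy, rfl⟩ := hrep q'
    rw [hH, hH] at e
    rw [h.leaf_injOn hK σ.2.1 σ.2.2 hx hy e]
  · rw [h.annulus_eq hK]
    ext p
    constructor
    · rintro ⟨x, rfl⟩
      change 0 ≤ height θ K _ ∧ height θ K _ ≤ 1
      rw [hheight]
      exact x.2.2
    · rintro ⟨hp0, hp1⟩
      have : p ∈ H '' (univ ×ˢ {⟨height θ K p, hp0, hp1⟩}) := by
        rw [← hlevel]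
        rfl
      exact image_subset_range _ _ this

/-! ### Invariance and rotation numbers of the leaves -/

theorem IsSpecialParameter.isRotSymInvariantCircle (hK : 3 ≤ K) {l : ℝ} (hl0 : 0 ≤ l)
    (hl1 : l ≤ 1) : IsRotSymInvariantCircle θ {p | height θ K p = l} where
  subset p hp := (h.mem_square_iff hK).2 (hl0.trans (le_of_eq (Eq.symm hp)))
  invariant := by
    rw [← h.range_leaf hK hl0 hl1]
    ext p
    constructor
    · rintro ⟨_, ⟨x, rfl⟩, rfl⟩
      exact ⟨_, (h.F_leaf hK hl0 hl1 x).symm⟩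
    · rintro ⟨x, rfl⟩
      refine ⟨_, ⟨x - l / (4 * quarter θ K l), rfl⟩, ?_⟩
      rw [h.F_leaf hK hl0 hl1, add_sub_cancel]
  order := ⟨_, _, h.isCcwParam_leaf hK hl0 hl1, h.isLiftAlong_leaf hK hl0 hl1⟩
  symmetric := by
    ext p
    constructor
    · rintro ⟨q, hq, rfl⟩
      exact (height_rot hK q).trans hq
    · intro hp
      exact ⟨rot^[3] p, (height_rot_iterate hK 3 p).trans hp, rot_four p⟩

theorem IsSpecialParameter.hasRotationNumber (hK : 3 ≤ K) {l : ℝ} (hl0 : 0 ≤ l)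
    (hl1 : l ≤ 1) :
    HasRotationNumber θ {p | height θ K p = l} (l / (4 * quarter θ K l)) := by
  have hq := h.quarter_pos hK hl0 hl1
  have hlt := h.lt_quarter hK hl0 hl1
  refine ⟨by positivity, ?_, _, _, h.isCcwParam_leaf hK hl0 hl1, h.isLiftAlong_leaf hK hl0 hl1,
    0, ?_⟩
  · rw [div_lt_one (by positivity)]
    linarith
  · rw [CircleDeg1Lift.translationNumber_translate, Int.cast_zero, add_zero]

theorem IsSpecialParameter.continuous_rotationNumber (hK : 3 ≤ K) :
    Continuous fun τ : unitInterval => (τ : ℝ) / (4 * quarter θ K τ) := by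
  have hc : Continuous fun τ : unitInterval => 4 * quarter θ K τ := by
    unfold quarter
    fun_prop
  exact continuous_subtype_val.div hc fun τ =>
    (mul_pos (by norm_num) (h.quarter_pos hK τ.2.1 τ.2.2)).ne'

theorem IsSpecialParameter.strictMono_rotationNumber (hK : 3 ≤ K) :
    StrictMono fun τ : unitInterval => (τ : ℝ) / (4 * quarter θ K τ) := by
  intro σ τ hlt
  have hlt : (σ : ℝ) < τ := hlt
  have hb := h.width_pos
  have hσ := h.quarter_pos hK σ.2.1 σ.2.2
  have hτ := h.quarter_pos hK τ.2.1 τ.2.2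
  simp only
  rw [div_lt_div_iff₀ (by positivity) (by positivity)]
  have e : τ * (4 * quarter θ K σ) - σ * (4 * quarter θ K τ) =
      4 * (τ - σ) / (1 - 2 * sc θ) := by
    unfold quarter
    field_simp
    ring
  have : 0 < 4 * ((τ : ℝ) - σ) / (1 - 2 * sc θ) := by
    have := sub_pos.2 hlt
    positivity
  linarith

theorem IsSpecialParameter.exists_foliation (hK : 3 ≤ K) :
    ∃ (Γ : unitInterval → Set (ℝ × ℝ)) (ρ : unitInterval → ℝ),
      IsCircleFoliation (annulus (Gamma0 θ K)) Γ ∧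
      Γ 0 = frontier square ∧
      Γ 1 = Gamma0 θ K ∧
      (∀ τ, IsRotSymInvariantCircle θ (Γ τ) ∧ HasRotationNumber θ (Γ τ) (ρ τ)) ∧
      Continuous ρ ∧ StrictMono ρ ∧ ρ 0 = 0 ∧ ρ 1 = 1 / (4 * (K : ℝ)) := by
  refine ⟨_, _, h.isCircleFoliation hK, (h.frontier_square hK).symm, (h.Gamma0_eq hK).symm,
    fun τ => ⟨h.isRotSymInvariantCircle hK τ.2.1 τ.2.2, h.hasRotationNumber hK τ.2.1 τ.2.2⟩,
    h.continuous_rotationNumber hK, h.strictMono_rotationNumber hK, ?_, ?_⟩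
  · simp
  · simp [quarter]

end special

/-! ### Existence of special parameters -/

/-- The solution of the recursion `x (i+2) = τ x (i+1) - x i` with given initial values. -/
def recSeq (τ x₀ x₁ : ℝ) : ℕ → ℝ
  | 0 => x₀
  | 1 => x₁
  | n + 2 => τ * recSeq τ x₀ x₁ (n + 1) - recSeq τ x₀ x₁ n

theorem recSeq_rec (τ x₀ x₁ : ℝ) (n : ℕ) :
    recSeq τ x₀ x₁ (n + 2) = τ * recSeq τ x₀ x₁ (n + 1) - recSeq τ x₀ x₁ n := by
  rw [recSeq]

/-- The orbit of `P 3` in the basis `P 0`, `P 3`. -/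
theorem vert_eq_comb {θ : ℝ} (h0 : 0 < θ) (h1 : θ < Real.pi / 4) (k : ℕ) :
    vert θ k = recSeq (traceB θ) 0 (tc θ * (1 - 2 * sc θ) / (sc θ - tc θ)) k • P θ 0 +
      recSeq (traceB θ) 1 (sc θ + tc θ) k • P θ 3 := by
  have hst := (sub_pos.2 (tc_lt_sc h0 h1)).ne'
  have hss := sc_sq θ
  induction k using Nat.twoStepInduction with
  | zero => simp [recSeq, vert]
  | one =>
    rw [vert_one h0 h1, P_three]
    ext
    · simp only [recSeq, P, Function.iterate_zero, id, Prod.fst_add, Prod.smul_fst, smul_eq_mul]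
      field_simp
      linear_combination tc θ * hss
    · simp only [recSeq, P, Function.iterate_zero, id, Prod.snd_add, Prod.smul_snd, smul_eq_mul]
      field_simp
      linear_combination sc θ * hss
  | more k ih1 ih2 =>
    rw [vert_rec h0 h1, ih1, ih2, recSeq_rec, recSeq_rec]
    module

/-- A solution of the recursion that is negative after a nonnegative value decreases from there. -/
theorem neg_of_rec {τ : ℝ} (hτ : 2 ≤ τ) {x : ℕ → ℝ} (hx : ∀ i, x (i + 2) = τ * x (i + 1) - x i)
    {n : ℕ} (hn : 0 ≤ x n) (hn1 : x (n + 1) < 0) {m : ℕ} (hm : n + 1 ≤ m) : x m < 0 := by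
  obtain ⟨i, rfl⟩ := Nat.exists_eq_add_of_le hm
  have key : ∀ i, x (n + 1 + i) < 0 ∧ x (n + 1 + i + 1) ≤ x (n + 1 + i) := by
    intro i
    induction i with
    | zero =>
      have := hx n
      exact ⟨hn1, by rw [Nat.add_zero, this]; nlinarith⟩
    | succ i ih =>
      have := hx (n + 1 + i)
      rw [show n + 1 + (i + 1) = n + 1 + i + 1 by ring]
      exact ⟨ih.2.trans_lt ih.1, by rw [this]; nlinarith [ih.1, ih.2]⟩
  exact (key i).1

/-- If the line from `E 0` to `P 0` contains the `K`-th point of the orbit of `P 3`, then the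
parameter is special. -/
theorem isSpecialParameter_of_recSeq_eq_zero {θ : ℝ} (h0 : 0 < θ) (h1 : θ < Real.pi / 4) {K : ℕ}
    (hz : recSeq (traceB θ) 1 (sc θ + tc θ) K = 0) : IsSpecialParameter K θ := by
  have ht := tc_pos h0 h1
  have hts := tc_lt_sc h0 h1
  have hs := sc_lt_half h0 h1
  have hst := sub_pos.2 hts
  have hβ : 0 < 1 - 2 * sc θ := by linarith
  have hτ := two_le_traceB h0 h1
  set a := recSeq (traceB θ) 0 (tc θ * (1 - 2 * sc θ) / (sc θ - tc θ)) with ha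
  set b := recSeq (traceB θ) 1 (sc θ + tc θ) with hb
  have harec : ∀ i, a (i + 2) = traceB θ * a (i + 1) - a i := recSeq_rec _ _ _
  have hbrec : ∀ i, b (i + 2) = traceB θ * b (i + 1) - b i := recSeq_rec _ _ _
  have ha0 : a 0 = 0 := rfl
  have ha1 : 0 < a 1 := by
    change 0 < tc θ * (1 - 2 * sc θ) / (sc θ - tc θ)
    positivity
  have hb0 : b 0 = 1 := rfl
  have hapos : ∀ i, 0 ≤ a i := fun i => by
    simpa using (rec_monotone hτ harec 0 ha0.ge (ha0.le.trans ha1.le) i).1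
  have hbpos : ∀ i ≤ K, 0 ≤ b i := by
    intro i hi
    induction i with
    | zero => rw [hb0]; exact zero_le_one
    | succ i ih =>
      by_contra hneg
      have := neg_of_rec hτ hbrec (ih (by omega)) (not_le.1 hneg) hi
      linarith
  have hcoord : ∀ k, vert θ k = a k • P θ 0 + b k • P θ 3 := vert_eq_comb h0 h1
  -- the determinant of a point and its image is invariant, which fixes the scale
  have hdet : ∀ k, (vert θ k).1 * (vert θ (k + 1)).2 - (vert θ k).2 * (vert θ (k + 1)).1 =
      -(tc θ * (1 - 2 * sc θ)) := by
    intro k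
    induction k with
    | zero =>
      rw [zero_add, vert_zero, vert_one h0 h1]
      ring
    | succ k ih => rw [vert_succ θ (k + 1), ← ih, vert_succ θ k, det_mapB h0 h1]
  have haK : a K = 1 := by
    have e1 : vert θ K = a K • P θ 0 := by rw [hcoord, hz, zero_smul, add_zero]
    have e2 : vert θ (K + 1) = a K • P' θ 0 := by
      rw [vert_succ, e1, mapB_smul, (mapB_vertices h0 h1).2.1]
    have e3 := hdet K
    rw [e1, e2] at e3
    simp only [P, P', Function.iterate_zero, id, Prod.smul_fst, Prod.smul_snd, smul_eq_mul] at e3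
    have e4 : a K ^ 2 = 1 := by
      apply mul_right_cancel₀ (mul_pos ht hβ).ne'
      linear_combination -e3
    nlinarith [hapos K]
  have hsum : ∀ k ≤ K, a k + b k ≤ 1 := by
    have hrec : ∀ i, a (i + 2) + b (i + 2) = traceB θ * (a (i + 1) + b (i + 1)) - (a i + b i) :=
      fun i => by rw [harec, hbrec]; ring
    intro k hk
    induction k with
    | zero => rw [ha0, hb0, zero_add]
    | succ k ih =>
      by_contra hgt
      have ih := ih (by omega)
      -- after an increase the sequence increases, which the value at `K` forbids
      have hmono := rec_monotone (x := fun i => a i + b i) hτ hrec k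
        (add_nonneg (hapos k) (hbpos k (by omega))) (by linarith)
      have hle : ∀ i, a (k + 1) + b (k + 1) ≤ a (k + 1 + i) + b (k + 1 + i) := by
        intro i
        induction i with
        | zero => exact le_rfl
        | succ i ih' =>
          have := (hmono (i + 1)).2
          rw [show k + (i + 1) = k + 1 + i by ring] at this
          exact ih'.trans this
      have := hle (K - (k + 1))
      rw [Nat.add_sub_cancel' hk, haK, hz] at this
      linarith
  have hmem : ∀ k ≤ K, ∀ c : ℝ, 0 ≤ c → c ≤ 1 → c • vert θ k ∈ pieceB θ 0 := by
    intro k hk c hc0 hc1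
    refine mem_pieceB_zero.2 ⟨c * a k, c * b k, mul_nonneg hc0 (hapos k),
      mul_nonneg hc0 (hbpos k hk), ?_, ?_⟩
    · nlinarith [hsum k hk, hapos k, hbpos k hk]
    · rw [hcoord, P_three]
      ext <;> simp [P] <;> ring
  have hiter : ∀ k ≤ K, ∀ c : ℝ, 0 ≤ c → c ≤ 1 → (F θ)^[k] (c • P θ 3) = c • vert θ k := by
    intro k hk c hc0 hc1
    induction k with
    | zero => rfl
    | succ k ih =>
      rw [Function.iterate_succ_apply', ih (by omega),
        F_of_mem_B h0 h1 (hmem k (by omega) c hc0 hc1), mapB_smul, vert_succ]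
  have hseg : ∀ p q : ℝ × ℝ, p ∈ segment ℝ (E 0) q ↔ ∃ c : ℝ, 0 ≤ c ∧ c ≤ 1 ∧ p = c • q := by
    intro p q
    constructor
    · rintro ⟨d, c, hd, hc, hdc, rfl⟩
      exact ⟨c, hc, by linarith, by simp [E]⟩
    · rintro ⟨c, hc0, hc1, rfl⟩
      exact ⟨1 - c, c, by linarith, hc0, by ring, by simp [E]⟩
  refine ⟨h0, h1, ?_, ?_⟩
  · rintro k hk _ ⟨p, hp, rfl⟩
    obtain ⟨c, hc0, hc1, rfl⟩ := (hseg _ _).1 hp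
    rw [hiter k hk.le c hc0 hc1]
    exact hmem k hk.le c hc0 hc1
  · have e1 : vert θ K = P θ 0 := by rw [hcoord, hz, haK, zero_smul, add_zero, one_smul]
    ext p
    rw [hseg]
    constructor
    · rintro ⟨q, hq, rfl⟩
      obtain ⟨c, hc0, hc1, rfl⟩ := (hseg _ _).1 hq
      exact ⟨c, hc0, hc1, by rw [hiter K le_rfl c hc0 hc1, e1]⟩
    · rintro ⟨c, hc0, hc1, rfl⟩
      exact ⟨c • P θ 3, (hseg _ _).2 ⟨c, hc0, hc1, rfl⟩, by rw [hiter K le_rfl c hc0 hc1, e1]⟩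

theorem sin_pos_of_lt {θ : ℝ} (h0 : 0 < θ) (h1 : θ ≤ Real.pi / 4) : 0 < Real.sin θ :=
  Real.sin_pos_of_pos_of_lt_pi h0 (by linarith [Real.pi_pos])

theorem sin_lt_cos {θ : ℝ} (h0 : 0 < θ) (h1 : θ < Real.pi / 4) : Real.sin θ < Real.cos θ := by
  have := tc_lt_sc h0 h1
  rw [tc, sc, sq] at this
  exact lt_of_mul_lt_mul_left this (sin_pos_of_lt h0 h1.le).le

/-- A formula for the trace that extends continuously to `θ = π/4`. -/
theorem traceB_eq {θ : ℝ} (h0 : 0 < θ) (h1 : θ < Real.pi / 4) :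
    traceB θ = 2 + (Real.cos θ - Real.sin θ) ^ 3 / Real.sin θ := by
  have hs := (sin_pos_of_lt h0 h1.le).ne'
  have hcs := (sub_pos.2 (sin_lt_cos h0 h1)).ne'
  have h := Real.sin_sq_add_cos_sq θ
  have e1 : 1 - 2 * sc θ = (Real.cos θ - Real.sin θ) ^ 2 := by
    rw [sc]; linear_combination -h
  have e2 : sc θ - tc θ = Real.sin θ * (Real.cos θ - Real.sin θ) := by
    rw [sc, tc]; ring
  rw [traceB, e1, e2]
  field_simp

/-- The coordinate of the `K`-th orbit point along `P 3`, extended to `θ = π/4`. -/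
def hitCoord (K : ℕ) (θ : ℝ) : ℝ :=
  recSeq (2 + (Real.cos θ - Real.sin θ) ^ 3 / Real.sin θ) 1 (sc θ + tc θ) K

theorem continuousOn_hitCoord (K : ℕ) : ContinuousOn (hitCoord K) (Ioc 0 (Real.pi / 4)) := by
  have hτ : ContinuousOn (fun θ : ℝ => 2 + (Real.cos θ - Real.sin θ) ^ 3 / Real.sin θ)
      (Ioc 0 (Real.pi / 4)) := by
    refine continuousOn_const.add (ContinuousOn.div (by fun_prop) (by fun_prop) ?_)
    exact fun θ hθ => (sin_pos_of_lt hθ.1 hθ.2).ne'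
  induction K using Nat.twoStepInduction with
  | zero => exact continuousOn_const
  | one =>
    change ContinuousOn (fun θ => sc θ + tc θ) _
    unfold sc tc
    fun_prop
  | more K ih1 ih2 => exact (hτ.mul ih2).sub ih1

theorem hitCoord_pi_div_four (K : ℕ) : hitCoord K (Real.pi / 4) = 1 := by
  have e1 : sc (Real.pi / 4) + tc (Real.pi / 4) = 1 := by
    have : √2 ^ 2 = 2 := Real.sq_sqrt (by norm_num)
    rw [sc, tc, Real.sin_pi_div_four, Real.cos_pi_div_four]
    linear_combination this / 2
  rw [hitCoord, e1, Real.sin_pi_div_four, Real.cos_pi_div_four, sub_self]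
  induction K using Nat.twoStepInduction with
  | zero => rfl
  | one => rfl
  | more K ih1 ih2 =>
    rw [recSeq_rec, ih1, ih2]
    norm_num

theorem hitCoord_eq {θ : ℝ} (h0 : 0 < θ) (h1 : θ < Real.pi / 4) (K : ℕ) :
    hitCoord K θ = recSeq (traceB θ) 1 (sc θ + tc θ) K := by
  rw [hitCoord, traceB_eq h0 h1]

theorem exists_isSpecialParameter_gt {θ : ℝ} (h0 : 0 < θ) (h1 : θ < Real.pi / 4) {K : ℕ}
    (hneg : hitCoord K θ < 0) : ∃ φ, θ < φ ∧ IsSpecialParameter K φ := by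
  have hcont : ContinuousOn (hitCoord K) (Icc θ (Real.pi / 4)) :=
    (continuousOn_hitCoord K).mono fun x hx => ⟨h0.trans_le hx.1, hx.2⟩
  obtain ⟨φ, hφ, e⟩ := intermediate_value_Ioo h1.le hcont
    (show (0 : ℝ) ∈ Ioo _ _ from ⟨hneg, by rw [hitCoord_pi_div_four]; exact one_pos⟩)
  refine ⟨φ, hφ.1, isSpecialParameter_of_recSeq_eq_zero (h0.trans hφ.1) hφ.2 ?_⟩
  rw [← hitCoord_eq (h0.trans hφ.1) hφ.2, e]

/-- If the initial ratio `r` is below the smaller root of `X² - τ X + 1`, then the solution of the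
recursion is eventually negative: as long as it is positive, the ratio of successive terms
drops by at least `r + r⁻¹ - τ` in each step. -/
theorem exists_recSeq_nonpos {τ r : ℝ} (hr0 : 0 < r) (hr1 : r < 1)
    (hr : τ < r + r⁻¹) : ∃ n, recSeq τ 1 r n ≤ 0 := by
  by_contra! hpos
  set x := recSeq τ 1 r with hx
  have hrec : ∀ i, x (i + 2) = τ * x (i + 1) - x i := recSeq_rec _ _ _
  obtain ⟨δ, hδ⟩ : ∃ δ, δ = r + r⁻¹ - τ := ⟨_, rfl⟩
  have hδ0 : 0 < δ := by linarith
  have key : ∀ k : ℕ, x (k + 1) ≤ (r - k * δ) * x k := by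
    intro k
    induction k with
    | zero => exact le_of_eq (by simp [hx, recSeq])
    | succ k ih =>
      obtain ⟨ρ, hρ⟩ : ∃ ρ, ρ = r - k * δ := ⟨_, rfl⟩
      have hk : 0 ≤ (k : ℝ) * δ := by positivity
      rw [← hρ] at ih
      have hρ0 : 0 < ρ := pos_of_mul_pos_left ((hpos (k + 1)).trans_le ih) (hpos k).le
      have hρr : ρ ≤ r := by linarith
      have hinv : r + r⁻¹ ≤ ρ + ρ⁻¹ := by
        have : ρ + ρ⁻¹ - (r + r⁻¹) = (r - ρ) * (1 - ρ * r) / (ρ * r) := by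
          field_simp
          ring
        have h2 : 0 ≤ (r - ρ) * (1 - ρ * r) / (ρ * r) := by
          have : 0 ≤ 1 - ρ * r := by nlinarith
          have := sub_nonneg.2 hρr
          positivity
        linarith
      have h3 : ρ⁻¹ * x (k + 1) ≤ x k := by
        rw [inv_mul_le_iff₀ hρ0]
        exact ih
      have h4 : r - (k + 1 : ℕ) * δ = ρ - δ := by push_cast; linarith
      have h5 := mul_le_mul_of_nonneg_right hinv (hpos (k + 1)).le
      rw [hrec, h4, hδ]
      nlinarith
  obtain ⟨k, hk⟩ := exists_nat_gt (r / δ)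
  rw [div_lt_iff₀ hδ0] at hk
  have := key k
  have := hpos (k + 1)
  nlinarith [hpos k]

theorem eventually_hitCoord_neg {θ : ℝ} (h0 : 0 < θ) (h1 : θ < Real.pi / 4) :
    ∀ᶠ K in atTop, hitCoord K θ < 0 := by
  have ht := tc_pos h0 h1
  have hts := tc_lt_sc h0 h1
  have hs := sc_lt_half h0 h1
  have hsin := sin_pos_of_lt h0 h1.le
  have hcs := sub_pos.2 (sin_lt_cos h0 h1)
  have hτ := two_le_traceB h0 h1
  have hne : sc θ + tc θ ≠ 0 := by linarith
  have hr : traceB θ < sc θ + tc θ + (sc θ + tc θ)⁻¹ := by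
    have e1 : sc θ + tc θ + (sc θ + tc θ)⁻¹ = 2 + (1 - sc θ - tc θ) ^ 2 / (sc θ + tc θ) := by
      field_simp
      ring
    have e2 : 1 - sc θ - tc θ = Real.cos θ * (Real.cos θ - Real.sin θ) := by
      rw [sc, tc]; linear_combination -Real.sin_sq_add_cos_sq θ
    have e3 : sc θ + tc θ = Real.sin θ * (Real.cos θ + Real.sin θ) := by rw [sc, tc]; ring
    rw [e1, e2, e3, traceB_eq h0 h1, add_lt_add_iff_left]
    have hcos : 0 < Real.cos θ := by linarith
    rw [div_lt_div_iff₀ hsin (by positivity)]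
    -- this reduces to `(cos θ - sin θ) (cos θ + sin θ) < cos θ ^ 2`
    have : (Real.cos θ * (Real.cos θ - Real.sin θ)) ^ 2 * Real.sin θ -
        (Real.cos θ - Real.sin θ) ^ 3 * (Real.sin θ * (Real.cos θ + Real.sin θ)) =
        (Real.cos θ - Real.sin θ) ^ 2 * Real.sin θ ^ 3 := by ring
    have : 0 < (Real.cos θ - Real.sin θ) ^ 2 * Real.sin θ ^ 3 := by positivity
    linarith
  obtain ⟨n, hn⟩ := exists_recSeq_nonpos (by linarith) (by linarith) hr
  have hrec := recSeq_rec (traceB θ) 1 (sc θ + tc θ)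
  -- the first nonpositive term is followed by a negative one
  classical
  have hex : ∃ n, recSeq (traceB θ) 1 (sc θ + tc θ) n ≤ 0 := ⟨n, hn⟩
  have hfind := Nat.find_spec hex
  have hmin : ∀ m < Nat.find hex, ¬ recSeq (traceB θ) 1 (sc θ + tc θ) m ≤ 0 :=
    fun m hm => Nat.find_min hex hm
  generalize Nat.find hex = N at hfind hmin
  rcases N with _ | N
  · exact absurd hfind (not_le.2 one_pos)
  have hN := not_le.1 (hmin N (Nat.lt_succ_self N))
  filter_upwards [eventually_ge_atTop (N + 2)] with K hK
  rw [hitCoord_eq h0 h1]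
  rcases hfind.lt_or_eq with hlt | heq
  · exact neg_of_rec hτ hrec hN.le hlt (by omega)
  · refine neg_of_rec hτ hrec (n := N + 1) heq.ge ?_ hK
    rw [hrec, heq]
    linarith

theorem hitCoord_arctan_neg {K : ℕ} (hK : 3 ≤ K) : hitCoord K (Real.arctan (1 / 4)) < 0 := by
  have h0 : 0 < Real.arctan (1 / 4) := Real.arctan_pos.2 (by norm_num)
  have h1 : Real.arctan (1 / 4) < Real.pi / 4 := by
    rw [← Real.arctan_one]
    exact Real.arctan_strictMono (by norm_num)
  have hcos : 0 < Real.cos (Real.arctan (1 / 4)) := Real.cos_arctan_pos _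
  have hsc : Real.sin (Real.arctan (1 / 4)) = Real.cos (Real.arctan (1 / 4)) / 4 := by
    have := Real.tan_arctan (1 / 4)
    rw [Real.tan_eq_sin_div_cos, div_eq_iff hcos.ne'] at this
    linarith
  have hsq := Real.sin_sq_add_cos_sq (Real.arctan (1 / 4))
  rw [hsc] at hsq
  have hc2 : Real.cos (Real.arctan (1 / 4)) ^ 2 = 16 / 17 := by linarith
  have hs : sc (Real.arctan (1 / 4)) = 4 / 17 := by rw [sc, hsc]; linarith
  have ht : tc (Real.arctan (1 / 4)) = 1 / 17 := by rw [tc, hsc]; linarith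
  have hτ : traceB (Real.arctan (1 / 4)) = 61 / 17 := by rw [traceB, hs, ht]; norm_num
  rw [hitCoord_eq h0 h1, hτ, hs, ht]
  refine neg_of_rec (τ := 61 / 17) (by norm_num) (recSeq_rec _ _ _) (n := 2) ?_ ?_ hK
  · norm_num [recSeq]
  · norm_num [recSeq]

theorem exists_special_parameters :
    ∃ θ : ℕ → ℝ, (∀ K ≥ 3, IsSpecialParameter K (θ K)) ∧ Tendsto θ atTop (𝓝 (Real.pi / 4)) := by
  have hne : ∀ K ≥ 3, {θ | IsSpecialParameter K θ}.Nonempty := by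
    intro K hK
    obtain ⟨φ, -, hφ⟩ := exists_isSpecialParameter_gt (Real.arctan_pos.2 (by norm_num))
      (by rw [← Real.arctan_one]; exact Real.arctan_strictMono (by norm_num))
      (hitCoord_arctan_neg hK)
    exact ⟨φ, hφ⟩
  have hbdd : ∀ K, BddAbove {θ | IsSpecialParameter K θ} := fun K =>
    ⟨Real.pi / 4, fun θ hθ => hθ.lt.le⟩
  -- special parameters that almost attain the supremum
  have hch : ∀ K, ∃ θ, 3 ≤ K → IsSpecialParameter K θ ∧
      sSup {θ | IsSpecialParameter K θ} - 1 / ((K : ℝ) + 1) < θ := by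
    intro K
    by_cases hK : 3 ≤ K
    · have hpos : 0 < 1 / ((K : ℝ) + 1) := by positivity
      obtain ⟨θ, h1, h2⟩ := exists_lt_of_lt_csSup (hne K hK)
        (show sSup {θ | IsSpecialParameter K θ} - 1 / ((K : ℝ) + 1) < _ by linarith)
      exact ⟨θ, fun _ => ⟨h1, h2⟩⟩
    · exact ⟨0, fun h => absurd h hK⟩
  choose θ hθ using hch
  refine ⟨θ, fun K hK => (hθ K hK).1, ?_⟩
  rw [Metric.tendsto_atTop']
  intro ε hε
  have hpi := Real.pi_pos
  obtain ⟨θ₀, h1, h2⟩ := exists_between (show max 0 (Real.pi / 4 - ε / 2) < Real.pi / 4 from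
    max_lt (by linarith) (by linarith))
  have hθ₀ := (le_max_left _ _).trans_lt h1
  have hθ₁ := (le_max_right _ _).trans_lt h1
  obtain ⟨N, hN⟩ := eventually_atTop.1 (((eventually_hitCoord_neg hθ₀ h2).and
    (eventually_ge_atTop 3)).and
    (tendsto_one_div_add_atTop_nhds_zero_nat.eventually_lt_const (half_pos hε)))
  refine ⟨N, fun K hK => ?_⟩
  obtain ⟨⟨hneg, hK3⟩, hsmall⟩ := hN K hK.le
  obtain ⟨φ, hφ, hφs⟩ := exists_isSpecialParameter_gt hθ₀ h2 hneg
  have hle := le_csSup (hbdd K) hφs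
  obtain ⟨hsp, hgt⟩ := hθ K hK3
  rw [Real.dist_eq, abs_lt]
  constructor <;> linarith [hsp.lt]

end

end SquareMap

open SquareMap
theorem corollary5p4 :
    (∃ θ : ℕ → ℝ, (∀ K ≥ 3, IsSpecialParameter K (θ K)) ∧
      Tendsto θ atTop (𝓝 (Real.pi / 4))) ∧
    ∀ (K : ℕ) (θ : ℝ), 3 ≤ K → IsSpecialParameter K θ →
      (∀ i < 4, P θ i ∈ Gamma0 θ K ∧ P' θ i ∈ Gamma0 θ K) ∧
      ∃ (Γ : unitInterval → Set (ℝ × ℝ)) (ρ : unitInterval → ℝ),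
        IsCircleFoliation (annulus (Gamma0 θ K)) Γ ∧
        Γ 0 = frontier square ∧
        Γ 1 = Gamma0 θ K ∧
        (∀ τ, IsRotSymInvariantCircle θ (Γ τ) ∧ HasRotationNumber θ (Γ τ) (ρ τ)) ∧
        Continuous ρ ∧ StrictMono ρ ∧ ρ 0 = 0 ∧ ρ 1 = 1 / (4 * (K : ℝ)) :=
  ⟨exists_special_parameters, fun _ _ hK h =>
    ⟨fun i _ => h.P_mem_Gamma0 hK i, h.exists_foliation hK⟩⟩
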